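/- **Theorem (Graph matrix norm bounds).** A *shape* $\alpha$ is a finite simple graph with vertex set $V(\alpha)$ and edge set $E(\alpha)$, together with two (possibly intersecting) subsets $U_\alpha, V_\alpha\subseteq V(\alpha)$ of left and right vertices. Let $W_\alpha=V(\alpha)\setminus(U_\alpha\cup V_\alpha)$ be the set of middle vertices, and let $W_{\mathrm{iso}}\subseteq W_\alpha$ be the set of middle vertices with no incident edge. A set $S\subseteq V(\alpha)$ is a $U_\alpha$–$V_\alpha$ vertex separator if every path from $U_\alpha$ to $V_\alpha$ (including one-vertex paths) contains a vertex of $S$; let $|S_{\min}|$ be the minimal size of such a separator. For a positive integer $n$ let $(\varepsilon_{e})$ be i.i.d. Rademacher random variables indexed by the edges $e=\{a,b\}$ of the complete graph on $[n]=\{1,\dots,n\}$, and let $M_\alpha$ be the $n^{|U_\alpha|}\times n^{|V_\alpha|}$ random matrix $$M_\alpha=\sum_{\varphi:V(\alpha)\to[n]\ \text{injective}}\Big(\prod_{\{i,j\}\in E(\alpha)}\varepsilon_{\{\varphi(i),\varphi(j)\}}\Big)\,e_{\varphi(U_\alpha)}\otimes e_{\varphi(V_\alpha)}^{\top},$$ whose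 rows and columns are indexed by $[n]^{U_\alpha}$ and $[n]^{V_\alpha}$, where $\varphi(U_\alpha)=(\varphi(u))_{u\in U_\alpha}$ and $\varphi(V_\alpha)=(\varphi(v))_{v\in V_\alpha}$. Let $\|\cdot\|$ be the operator norm and set $$f(\alpha)=|S_{\min}|-|U_\alpha\cap V_\alpha|+|W_\alpha|-|W_{\mathrm{iso}}|.$$ Then for every shape $\alpha$ there are constants $c_\alpha,C_\alpha>0$ depending only on $\alpha$ such that $$\mathbb E\|M_\alpha\|\le C_\alpha\, n^{\frac12(|V(\alpha)|-|S_{\min}|+|W_{\mathrm{iso}}|)}\,(\log n)^{\frac12 f(\alpha)}\quad\text{for all } n\ge 1,$$ and $$\mathbb E\|M_\alpha\|\ge c_\alpha\, n^{\frac12(|V(\alpha)|-|S_{\min}|+|W_{\mathrm{iso}}|)}\quad\text{for all } n\ge |V(\alpha)|,\ n\ge 1,$$ with the convention $0^0=1$. -/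

import Mathlib

open scoped Matrix.Norms.L2Operator

/-- A shape: a (simple) graph on the vertex set `V` with a set `left` of left vertices and a
set `right` of right vertices. The two sets may intersect and need not cover `V`. -/
structure Shape (V : Type*) where
  graph : SimpleGraph V
  left : Finset V
  right : Finset V

namespace Shape

section Combinatorics

variable {V : Type*} [Fintype V] [DecidableEq V] (α : Shape V)

/-- The middle vertices: those that are neither left nor right vertices. -/
def middle : Finset V := Finset.univ \ (α.left ∪ α.right)

open Classical in
/-- The isolated middle vertices: middle vertices without any incident edge. -/
noncomputable def isolatedMiddle : Finset V :=
  α.middle.filter fun v => α.graph.IsIsolated v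

/-- `S` is a left-right vertex separator: every path of the graph from a left vertex to a right
vertex (paths with a single vertex included) passes through `S`. -/
def IsVertexSeparator (S : Finset V) : Prop :=
  ∀ u ∈ α.left, ∀ v ∈ α.right, ∀ p : α.graph.Walk u v, p.IsPath → ∃ x ∈ p.support, x ∈ S

/-- The smallest size of a left-right vertex separator. -/
noncomputable def minSeparatorCard : ℕ :=
  sInf {k | ∃ S : Finset V, α.IsVertexSeparator S ∧ S.card = k}

/-- The exponent `|V(α)| - |S_min| + |W_iso|`. -/
noncomputable def polyExponent : ℝ :=
  (Fintype.card V : ℝ) - α.minSeparatorCard + α.isolatedMiddle.card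

/-- The exponent `f(α) = |S_min| - |U_α ∩ V_α| + |W_α| - |W_iso|`. -/
noncomputable def logExponent : ℝ :=
  (α.minSeparatorCard : ℝ) - (α.left ∩ α.right).card + α.middle.card - α.isolatedMiddle.card

end Combinatorics

/-- The minimum in `minSeparatorCard` is attained. -/
theorem exists_separator_card_eq {V : Type*} [Fintype V] (α : Shape V) :
    ∃ S : Finset V, α.IsVertexSeparator S ∧ S.card = α.minSeparatorCard :=
  Nat.sInf_mem (s := {k | ∃ S : Finset V, α.IsVertexSeparator S ∧ S.card = k})
    ⟨_, Finset.univ, fun u _ _ _ p _ => ⟨u, p.start_mem_support, Finset.mem_univ u⟩, rfl⟩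

/-- The edge of the complete graph on `Fin n` onto which a realization (an injective map from the
shape vertices to `Fin n`) maps an edge of the shape. -/
def mapEdge {V : Type*} (α : Shape V) {n : ℕ} (φ : V ↪ Fin n) :
    α.graph.edgeSet → (⊤ : SimpleGraph (Fin n)).edgeSet :=
  SimpleGraph.Hom.mapEdgeSet (G := α.graph) (G' := ⊤) ⟨φ, fun h => φ.injective.ne h.ne⟩

open Classical in
/-- The graph matrix of a shape, as a function of the values `x` attached to the edges of the
complete graph on `Fin n`: the sum over all realizations `φ` of
`(∏ x (φ e)) • e_{φ(U)} ⊗ e_{φ(V)}ᵀ`, the product being over the edges `e` of the shape.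
Rows and columns are indexed by the tuples of elements of `Fin n` indexed by the left and by the
right vertices, and `φ(U)`, `φ(V)` are the restrictions of `φ`. -/
noncomputable def graphMatrix {V : Type*} [Fintype V] (α : Shape V) (n : ℕ)
    (x : (⊤ : SimpleGraph (Fin n)).edgeSet → ℝ) :
    Matrix (α.left → Fin n) (α.right → Fin n) ℝ :=
  ∑ φ : V ↪ Fin n,
    Matrix.single (fun u : α.left => φ u) (fun v : α.right => φ v)
      (∏ e : α.graph.edgeSet, x (α.mapEdge φ e))

end Shape

/-- A family of independent Rademacher (uniform `±1`) random variables. -/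
structure IsRademacherFamily {ι Ω : Type*} [MeasurableSpace Ω] (ε : ι → Ω → ℝ)
    (P : MeasureTheory.Measure Ω) : Prop where
  measurable : ∀ i, Measurable (ε i)
  prob_one : ∀ i, P {ω | ε i ω = 1} = 1 / 2
  prob_neg_one : ∀ i, P {ω | ε i ω = -1} = 1 / 2
  indep : ProbabilityTheory.iIndepFun ε P

/-! By `IsRademacherFamily.integral_eq_expect` every integral in question is a uniform average over
sign patterns.

Upper bound (moment method). Let q be a power of two comparable to log n. Then ‖M‖^(2q) is at most
the trace of (M Mᵀ)^q, and the average of this trace is at most the number of sequences of 2q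
realizations that share right and left labels alternately and in which the labels of each edge recur
together at another time (`Shape.expect_norm_pow_le`). At a given time, let F and G be the sets of
vertices whose labels occur there for the first and for the last time. Recurrence forbids edges
between F and G. Away from the two ends of the sequence, one of the sets U, V avoids F and the other
avoids G, so a path from U to V cannot stay inside F ∪ G. The complement of F ∪ G is therefore a
separator, and F ∩ G consists of isolated middle vertices, whence |F| + |G| ≤ |V(α)| + |W_iso| -
|S_min|. Summing over all times bounds the number of distinct labels
(`Shape.IsRepeatedChain.card_labels_add_le`), and a weighted count of the sequences
(`Shape.card_isRepeatedChain_le`) gives the bound after taking a root of order 2q.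

Lower bound. Give each vertex its own column of about n/|V(α)| labels. Twisting the edge signs by
signs attached to color classes, and averaging, extracts the realizations that respect the columns
without increasing the expected norm (`Shape.expect_norm_colored_le`). Isolated middle vertices only
contribute a multiplicity. Pin the vertices of a minimum separator to one label each: the labels on
its two sides can then be recombined freely, so all two-by-two minors vanish
(`Shape.gridMatrix_minor`) and the operator norm equals the Frobenius norm. The mean square of the
latter is at least the number of remaining label choices, and Bonami's inequality turns this second
moment into a first moment. -/

open scoped BigOperators
open Finset MeasureTheory

/-- The real vector of values of a sign pattern. -/
def signVal {ι : Type*} (x : ι → ℤˣ) : ι → ℝ := fun i => ((x i : ℤ) : ℝ)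

/-! ### Rademacher monomials and uniform averages over sign patterns -/

section Signs

variable {ι : Type*}

theorem signVal_mul (x y : ι → ℤˣ) (i : ι) : signVal (x * y) i = signVal x i * signVal y i := by
  simp [signVal]

theorem signVal_sq (x : ι → ℤˣ) (i : ι) : signVal x i * signVal x i = 1 := by
  rcases Int.units_eq_one_or (x i) with h | h <;> simp [signVal, h]

theorem signVal_eq_one_or (x : ι → ℤˣ) (i : ι) : signVal x i = 1 ∨ signVal x i = -1 := by
  rcases Int.units_eq_one_or (x i) with h | h <;> simp [signVal, h]

theorem prod_signVal_eq_one_or {I : Type*} (s : Finset I) (x : ι → ℤˣ) (e : I → ι) :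
    ∏ i ∈ s, signVal x (e i) = 1 ∨ ∏ i ∈ s, signVal x (e i) = -1 := by
  classical
  induction s using Finset.induction_on with
  | empty => simp
  | insert a s ha ih =>
    rw [prod_insert ha]
    rcases signVal_eq_one_or x (e a) with h | h <;> rcases ih with h' | h' <;> simp [h, h']

variable [Fintype ι] [DecidableEq ι]

theorem expect_mul_right (G : (ι → ℤˣ) → ℝ) (y : ι → ℤˣ) : 𝔼 x, G (x * y) = 𝔼 x, G x :=
  Fintype.expect_equiv (Equiv.mulRight y) _ _ fun _ => rfl

theorem expect_eq_zero_of_flip (G : (ι → ℤˣ) → ℝ) (y : ι → ℤˣ) (h : ∀ x, G (x * y) = - G x) :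
    𝔼 x, G x = 0 := by
  have h1 := expect_mul_right G y
  simp only [h, expect_neg_distrib] at h1
  linarith

/-- A Rademacher monomial is either identically one or has vanishing mean. -/
theorem expect_prod_signVal {I : Type*} (s : Finset I) (e : I → ι) :
    ((∀ y : ι → ℤˣ, ∏ i ∈ s, signVal y (e i) = 1) ∧ 𝔼 x, ∏ i ∈ s, signVal x (e i) = 1) ∨
      𝔼 x, ∏ i ∈ s, signVal x (e i) = 0 := by
  by_cases h : ∀ y : ι → ℤˣ, ∏ i ∈ s, signVal y (e i) = 1
  · exact Or.inl ⟨h, by simp [h]⟩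
  · push Not at h
    obtain ⟨y, hy⟩ := h
    have hy := (prod_signVal_eq_one_or s y e).resolve_left hy
    exact Or.inr (expect_eq_zero_of_flip _ y fun x => by
      simp [signVal_mul, prod_mul_distrib, hy])

theorem expect_prod_signVal_nonneg {I : Type*} (s : Finset I) (e : I → ι) :
    0 ≤ 𝔼 x, ∏ i ∈ s, signVal x (e i) := by
  rcases expect_prod_signVal s e with ⟨-, h⟩ | h <;> rw [h]; norm_num

theorem expect_prod_signVal_le_one {I : Type*} (s : Finset I) (e : I → ι) :
    𝔼 x, ∏ i ∈ s, signVal x (e i) ≤ 1 := by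
  rcases expect_prod_signVal s e with ⟨-, h⟩ | h <;> rw [h]; norm_num

/-- If a Rademacher monomial has nonzero mean, then each of its factors is repeated. -/
theorem exists_ne_of_expect_prod_ne_zero {I : Type*} (s : Finset I) (e : I → ι)
    (h : 𝔼 x, ∏ i ∈ s, signVal x (e i) ≠ 0) (i : I) (hi : i ∈ s) :
    ∃ j ∈ s, j ≠ i ∧ e j = e i := by
  classical
  by_contra! hc
  -- Flipping only the sign at `e i` would negate the monomial if no other factor used `e i`.
  have h1 := ((expect_prod_signVal s e).resolve_right h).1 (Function.update 1 (e i) (-1))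
  rw [← mul_prod_erase s _ hi, prod_eq_one] at h1
  · norm_num [signVal] at h1
  · intro j hj
    rw [mem_erase] at hj
    simp [signVal, Function.update_of_ne (hc j hj.2 hj.1)]

/-- The law of a Rademacher family is the uniform law on sign patterns. -/
theorem IsRademacherFamily.integral_eq_expect {Ω : Type*} [MeasurableSpace Ω] {P : Measure Ω}
    [IsProbabilityMeasure P] {ε : ι → Ω → ℝ} (h : IsRademacherFamily ε P) (g : (ι → ℝ) → ℝ) :
    ∫ ω, g (fun i => ε i ω) ∂P = 𝔼 x : ι → ℤˣ, g (signVal x) := by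
  classical
  -- The events `A x` are disjoint, cover almost all of Ω, and by independence all have the same
  -- probability.
  let A : (ι → ℤˣ) → Set Ω := fun x => ⋂ i ∈ (univ : Finset ι), ε i ⁻¹' {signVal x i}
  have hA : ∀ x, MeasurableSet (A x) := fun x =>
    Finset.measurableSet_biInter _ fun i _ => h.measurable i (measurableSet_singleton _)
  have hmemA : ∀ x ω, ω ∈ A x ↔ ∀ i, ε i ω = signVal x i := fun x ω => by simp [A]
  have hP1 : ∀ (x : ι → ℤˣ) i, P (ε i ⁻¹' {signVal x i}) = 1 / 2 := fun x i => by
    rcases signVal_eq_one_or x i with hx | hx <;> rw [hx]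
    exacts [h.prob_one i, h.prob_neg_one i]
  have hPA : ∀ x, P (A x) = (1 / 2) ^ Fintype.card ι := fun x => by
    rw [h.indep.measure_inter_preimage_eq_mul univ fun i _ => measurableSet_singleton _]
    simp [hP1]
  have hae : ∀ᵐ ω ∂P, ∃ x, ω ∈ A x := by
    have h1 : ∀ᵐ ω ∂P, ∀ i, ε i ω = 1 ∨ ε i ω = -1 := by
      rw [ae_all_iff]
      intro i
      have hm : ∀ c : ℝ, MeasurableSet {ω | ε i ω = c} := fun c =>
        h.measurable i (measurableSet_singleton _)
      have : P ({ω | ε i ω = 1} ∪ {ω | ε i ω = -1}) = 1 := by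
        rw [measure_union _ (hm _), h.prob_one, h.prob_neg_one, ENNReal.add_halves]
        rw [Set.disjoint_left]
        intro ω h1 h2
        simp only [Set.mem_ofPred_eq] at h1 h2
        linarith
      exact (mem_ae_iff_prob_eq_one ((hm _).union (hm _))).2 this
    filter_upwards [h1] with ω hω
    refine ⟨fun i => if ε i ω = 1 then 1 else -1, (hmemA _ _).2 fun i => ?_⟩
    rcases hω i with h2 | h2 <;> simp [signVal, h2]
    norm_num
  have hdisj : ∀ x y ω, ω ∈ A x → ω ∈ A y → x = y := fun x y ω hx hy => by
    rw [hmemA] at hx hy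
    ext i
    have := (hx i).symm.trans (hy i)
    simpa [signVal] using this
  have heq : (fun ω => g fun i => ε i ω) =ᵐ[P]
      fun ω => ∑ x, (A x).indicator (fun _ => g (signVal x)) ω := by
    filter_upwards [hae] with ω hω
    obtain ⟨x, hx⟩ := hω
    rw [sum_eq_single x]
    · rw [Set.indicator_of_mem hx]
      congr 1
      ext i
      exact (hmemA _ _).1 hx i
    · intro y _ hy
      exact Set.indicator_of_notMem (fun hy' => hy (hdisj _ _ _ hy' hx)) _
    · simp
  rw [integral_congr_ae heq, integral_finsetSum]
  · rw [Fintype.expect_eq_sum_div_card, sum_div]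
    refine sum_congr rfl fun x _ => ?_
    rw [integral_indicator_const _ (hA x), measureReal_def, hPA]
    simp [div_eq_inv_mul]
  · intro x _
    exact (integrable_const _).indicator (hA x)

end Signs

/-! ### Operator norm against traces and Frobenius norms -/

section Norms

set_option linter.unusedSectionVars false

variable {m n : Type*} [Fintype m] [Fintype n] [DecidableEq m] [DecidableEq n]

theorem l2_opNorm_sq_le_sum_sq (A : Matrix m n ℝ) : ‖A‖ ^ 2 ≤ ∑ i, ∑ j, A i j ^ 2 := by
  have h0 : (0 : ℝ) ≤ ∑ i, ∑ j, A i j ^ 2 := by positivity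
  have h : ‖A‖ ≤ √(∑ i, ∑ j, A i j ^ 2) := by
    rw [Matrix.l2_opNorm_def]
    refine ContinuousLinearMap.opNorm_le_bound _ (Real.sqrt_nonneg _) fun x => ?_
    rw [EuclideanSpace.norm_eq, EuclideanSpace.norm_eq, ← Real.sqrt_mul h0]
    refine Real.sqrt_le_sqrt ?_
    rw [sum_mul]
    refine sum_le_sum fun i _ => ?_
    have := sum_mul_sq_le_sq_mul_sq univ (fun j => A i j) (fun j => x j)
    simpa [Matrix.mulVec, dotProduct] using this
  calc ‖A‖ ^ 2 ≤ √(∑ i, ∑ j, A i j ^ 2) ^ 2 := by gcongr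
    _ = _ := Real.sq_sqrt h0

theorem l2_opNorm_transpose (A : Matrix m n ℝ) : ‖A.transpose‖ = ‖A‖ := by
  rw [← Matrix.conjTranspose_eq_transpose_of_trivial, Matrix.l2_opNorm_conjTranspose]

/-- For the self-adjoint A = M Mᵀ the norm is multiplicative under repeated squaring, which is why
the exponents are powers of two. The squared Frobenius norm of A^(2^k) is the trace of A^(2^(k+1)).
-/
theorem l2_opNorm_pow_le_trace (M : Matrix m n ℝ) (k : ℕ) :
    ‖M‖ ^ (2 * 2 ^ k) ≤ ((M * M.transpose) ^ (2 ^ k)).trace := by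
  cases k with
  | zero =>
    refine (le_of_eq (by norm_num)).trans ((l2_opNorm_sq_le_sum_sq M).trans (le_of_eq ?_))
    simp [Matrix.trace, Matrix.mul_apply, sq]
  | succ k =>
    set A := M * M.transpose with hAdef
    have hA : A.transpose = A := by simp [A]
    have hsa : IsSelfAdjoint A := by
      rw [IsSelfAdjoint, Matrix.star_eq_conjTranspose,
        Matrix.conjTranspose_eq_transpose_of_trivial, hA]
    have hnorm : ‖A‖ = ‖M‖ ^ 2 := by
      have := Matrix.l2_opNorm_conjTranspose_mul_self M.transpose
      rw [Matrix.conjTranspose_eq_transpose_of_trivial, Matrix.transpose_transpose,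
        l2_opNorm_transpose] at this
      rw [hAdef, this, sq]
    have h1 : ‖A ^ 2 ^ k‖ = ‖A‖ ^ 2 ^ k := by
      have := hsa.nnnorm_pow_two_pow k
      simpa using congrArg NNReal.toReal this
    calc ‖M‖ ^ (2 * 2 ^ (k + 1)) = ‖A ^ 2 ^ k‖ ^ 2 := by
          rw [h1, hnorm]; ring
      _ ≤ _ := l2_opNorm_sq_le_sum_sq _
      _ = (A ^ 2 ^ k * (A ^ 2 ^ k).transpose).trace := by
          simp [Matrix.trace, Matrix.mul_apply, sq, -Matrix.transpose_pow]
      _ = _ := by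
          rw [Matrix.transpose_pow, hA, ← pow_add]
          congr 2
          ring

/-- For a matrix whose two-by-two minors vanish, the Frobenius norm is at most the operator
norm. -/
theorem sum_sq_le_l2_opNorm_sq (Q : Matrix m n ℝ)
    (h : ∀ i j i' j', Q i j * Q i' j' = Q i j' * Q i' j) :
    ∑ i, ∑ j, Q i j ^ 2 ≤ ‖Q‖ ^ 2 := by
  set F := ∑ i, ∑ j, Q i j ^ 2 with hF
  have h0 : (0 : ℝ) ≤ F := by positivity
  -- The vanishing minor turns Q i j' * Q i' j into Q i j * Q i' j', which leaves Q i j times the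
  -- sum of all squares. Taking norms then bounds F.
  have h1 : Q * Q.transpose * Q = F • Q := by
    ext i j
    simp only [Matrix.mul_apply, Matrix.transpose_apply, Matrix.smul_apply, smul_eq_mul, hF,
      sum_mul]
    refine sum_congr rfl fun i' _ => sum_congr rfl fun j' _ => ?_
    have := h i j' i' j
    rw [mul_right_comm, this]
    ring
  have h2 : F * ‖Q‖ ≤ ‖Q‖ ^ 2 * ‖Q‖ := by
    calc F * ‖Q‖ = ‖Q * Q.transpose * Q‖ := by rw [h1, norm_smul, Real.norm_of_nonneg h0]
      _ ≤ ‖Q * Q.transpose‖ * ‖Q‖ := Matrix.l2_opNorm_mul _ _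
      _ ≤ ‖Q‖ * ‖Q.transpose‖ * ‖Q‖ := by gcongr; exact Matrix.l2_opNorm_mul _ _
      _ = _ := by rw [l2_opNorm_transpose]; ring
  by_cases hQ : Q = 0
  · simp [hF, hQ]
  · exact le_of_mul_le_mul_right h2 (norm_pos_iff.2 hQ)

theorem norm_boole_le_one (r : m → Prop) [DecidablePred r] :
    ‖fun i => if r i then (1 : ℝ) else 0‖ ≤ 1 := by
  rw [pi_norm_le_iff_of_nonneg zero_le_one]
  intro i
  split_ifs <;> simp

/-- Setting rows and columns of a matrix to zero does not increase its norm. -/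
theorem l2_opNorm_restrict_le (Q : Matrix m n ℝ) (p : m → Prop) (q : n → Prop)
    [DecidablePred p] [DecidablePred q] :
    ‖Matrix.of fun i j => if p i ∧ q j then Q i j else 0‖ ≤ ‖Q‖ := by
  have h1 : (Matrix.of fun i j => if p i ∧ q j then Q i j else 0) =
      Matrix.diagonal (fun i => if p i then (1 : ℝ) else 0) * Q *
        Matrix.diagonal (fun j => if q j then (1 : ℝ) else 0) := by
    ext i j
    rw [Matrix.mul_diagonal, Matrix.diagonal_mul]
    by_cases hp : p i <;> by_cases hq : q j <;> simp [hp, hq]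
  rw [h1]
  refine (Matrix.l2_opNorm_mul _ _).trans ?_
  refine (mul_le_mul (Matrix.l2_opNorm_mul _ _) le_rfl (norm_nonneg _) (by positivity)).trans ?_
  rw [Matrix.l2_opNorm_diagonal, Matrix.l2_opNorm_diagonal]
  calc _ ≤ 1 * ‖Q‖ * 1 := by gcongr <;> exact norm_boole_le_one _
    _ = ‖Q‖ := by ring

end Norms

/-! ### Fourth moments of Rademacher polynomials and comparison of first and second moments -/

section Hypercontractivity

set_option linter.unusedSectionVars false

variable {ι : Type*} [Fintype ι] [DecidableEq ι]

/-- The sign pattern that is `-1` at `j` only. -/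
def flipAt (j : ι) : ι → ℤˣ := Function.update 1 j (-1)

theorem expect_mul_signVal_eq_zero (G : (ι → ℤˣ) → ℝ) (j : ι)
    (hG : ∀ x, G (x * flipAt j) = G x) : 𝔼 x, signVal x j * G x = 0 := by
  refine expect_eq_zero_of_flip _ (flipAt j) fun x => ?_
  rw [hG, signVal_mul]
  simp [signVal, flipAt]

theorem signMonomial_flip {S : Finset ι} {j : ι} (hj : j ∉ S) (x : ι → ℤˣ) :
    ∏ i ∈ S, signVal (x * flipAt j) i = ∏ i ∈ S, signVal x i := by
  refine prod_congr rfl fun i hi => ?_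
  rw [signVal_mul]
  have : i ≠ j := fun h => hj (h ▸ hi)
  simp [signVal, flipAt, Function.update_of_ne this]

/-- Bonami's fourth moment bound for Rademacher polynomials of degree at most `d`. -/
theorem bonami_fourth_moment {I : Type*} (J : Finset ι) :
    ∀ (s : Finset I) (S : I → Finset ι) (d : ℕ), (∀ i ∈ s, S i ⊆ J) → (∀ i ∈ s, (S i).card ≤ d) →
      ∀ c : I → ℝ,
        𝔼 x, (∑ i ∈ s, c i * ∏ e ∈ S i, signVal x e) ^ 4 ≤
          9 ^ d * (𝔼 x, (∑ i ∈ s, c i * ∏ e ∈ S i, signVal x e) ^ 2) ^ 2 := by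
  classical
  induction J using Finset.induction_on with
  | empty =>
    intro s S d hS _ c
    have h : ∀ x : ι → ℤˣ, ∑ i ∈ s, c i * ∏ e ∈ S i, signVal x e = ∑ i ∈ s, c i := fun x =>
      sum_congr rfl fun i hi => by simp [subset_empty.1 (hS i hi)]
    simp only [h, Fintype.expect_const]
    rw [← pow_mul]
    exact le_mul_of_one_le_left (by positivity) (one_le_pow₀ (by norm_num))
  | insert j J hj ih =>
    intro s S d hS hd c
    -- The polynomial is split as g + x_j h with g and h free of x_j. Odd powers of x_j average to
    -- zero, and h has degree at most d - 1.
    let s0 := s.filter fun i => j ∉ S i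
    let s1 := s.filter fun i => j ∈ S i
    let g : (ι → ℤˣ) → ℝ := fun x => ∑ i ∈ s0, c i * ∏ e ∈ S i, signVal x e
    let h : (ι → ℤˣ) → ℝ := fun x => ∑ i ∈ s1, c i * ∏ e ∈ (S i).erase j, signVal x e
    have hdec : ∀ x, ∑ i ∈ s, c i * ∏ e ∈ S i, signVal x e = g x + signVal x j * h x := by
      intro x
      rw [← sum_filter_add_sum_filter_not s fun i => j ∉ S i]
      congr 1
      simp only [not_not, h, mul_sum]
      refine sum_congr rfl fun i hi => ?_
      rw [← mul_prod_erase (S i) _ (mem_filter.1 hi).2]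
      ring
    have hg0 : ∀ x, g (x * flipAt j) = g x := fun x =>
      sum_congr rfl fun i hi => by rw [signMonomial_flip (mem_filter.1 hi).2]
    have hh0 : ∀ x, h (x * flipAt j) = h x := fun x =>
      sum_congr rfl fun i hi => by rw [signMonomial_flip (notMem_erase j _)]
    have hg4 : 𝔼 x, g x ^ 4 ≤ 9 ^ d * (𝔼 x, g x ^ 2) ^ 2 := by
      refine ih s0 S d (fun i hi => ?_) (fun i hi => hd i (mem_filter.1 hi).1) c
      exact (subset_insert_iff_of_notMem (mem_filter.1 hi).2).1 (hS i (mem_filter.1 hi).1)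
    have hsq : ∀ x : ι → ℤˣ, signVal x j ^ 2 = 1 := fun x => by rw [sq, signVal_sq]
    have hE2 : 𝔼 x, (g x + signVal x j * h x) ^ 2 = 𝔼 x, g x ^ 2 + 𝔼 x, h x ^ 2 := by
      have h1 : ∀ x : ι → ℤˣ, (g x + signVal x j * h x) ^ 2 =
          g x ^ 2 + h x ^ 2 + signVal x j * (2 * g x * h x) := fun x => by
        linear_combination h x ^ 2 * hsq x
      simp only [h1, expect_add_distrib]
      rw [expect_mul_signVal_eq_zero _ j fun x => by rw [hg0, hh0], add_zero]
    have hE4 : 𝔼 x, (g x + signVal x j * h x) ^ 4 =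
        𝔼 x, g x ^ 4 + 6 * 𝔼 x, g x ^ 2 * h x ^ 2 + 𝔼 x, h x ^ 4 := by
      have h1 : ∀ x : ι → ℤˣ, (g x + signVal x j * h x) ^ 4 =
          g x ^ 4 + 6 * (g x ^ 2 * h x ^ 2) + h x ^ 4 +
            signVal x j * (4 * g x ^ 3 * h x + 4 * g x * h x ^ 3) := fun x => by
        linear_combination (6 * g x ^ 2 * h x ^ 2 + 4 * g x * h x ^ 3 * signVal x j +
          h x ^ 4 * (signVal x j ^ 2 + 1)) * hsq x
      simp only [h1, expect_add_distrib]
      rw [expect_mul_signVal_eq_zero _ j fun x => by rw [hg0, hh0], add_zero, mul_expect]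
    simp only [hdec]
    rw [hE2, hE4]
    have hpg : 0 ≤ 𝔼 x, g x ^ 2 := expect_nonneg fun _ _ => by positivity
    have hph : 0 ≤ 𝔼 x, h x ^ 2 := expect_nonneg fun _ _ => by positivity
    cases d with
    | zero =>
      have hs1 : s1 = ∅ := by
        rw [filter_eq_empty_iff]
        intro i hi hji
        have := hd i hi
        rw [Nat.le_zero, card_eq_zero] at this
        simp [this] at hji
      have hh : ∀ x, h x = 0 := fun x => by simp [h, hs1]
      simpa [hh] using hg4
    | succ d =>
      have hh4 : 𝔼 x, h x ^ 4 ≤ 9 ^ d * (𝔼 x, h x ^ 2) ^ 2 := by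
        refine ih s1 (fun i => (S i).erase j) d (fun i hi => ?_) (fun i hi => ?_) c
        · exact subset_insert_iff.1 (hS i (mem_filter.1 hi).1)
        · rw [card_erase_of_mem (mem_filter.1 hi).2]
          have := hd i (mem_filter.1 hi).1
          omega
      set a := 𝔼 x, g x ^ 2
      set b := 𝔼 x, h x ^ 2
      -- Cauchy–Schwarz with both induction hypotheses. The coefficient 6 * 3 * 9^d = 2 * 9^(d+1) is
      -- exactly that of the cross term in 9^(d+1) (a + b)².
      have hcs : 𝔼 x, g x ^ 2 * h x ^ 2 ≤ 3 * 9 ^ d * (a * b) := by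
        have h1 := expect_mul_sq_le_sq_mul_sq univ (fun x => g x ^ 2) fun x => h x ^ 2
        simp only [← pow_mul] at h1
        refine le_of_sq_le_sq ?_ (by positivity)
        refine h1.trans ?_
        calc _ ≤ (9 ^ (d + 1) * a ^ 2) * (9 ^ d * b ^ 2) :=
              mul_le_mul hg4 hh4 (expect_nonneg fun _ _ => by positivity) (by positivity)
          _ = _ := by ring
      have h9 : (0 : ℝ) ≤ 9 ^ d := by positivity
      calc _ ≤ 9 ^ (d + 1) * a ^ 2 + 6 * (3 * 9 ^ d * (a * b)) + 9 ^ d * b ^ 2 := by gcongr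
        _ ≤ _ := by
          rw [pow_succ]
          nlinarith [mul_nonneg h9 (sq_nonneg b)]

/-- A nonnegative variable whose second moment is controlled by its mean has a square root of
comparable mean. -/
theorem sqrt_expect_le {Y : (ι → ℤˣ) → ℝ} (hY : ∀ x, 0 ≤ Y x) {K : ℝ} (hK : 0 < K)
    (h : 𝔼 x, Y x ^ 2 ≤ K * (𝔼 x, Y x) ^ 2) :
    √(𝔼 x, Y x) / (2 * √(2 * K)) ≤ 𝔼 x, √(Y x) := by
  set m := 𝔼 x, Y x with hm
  have hm0 : 0 ≤ m := expect_nonneg fun x _ => hY x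
  rcases hm0.eq_or_lt with h0 | hpos
  · rw [← h0]
    simp only [Real.sqrt_zero, zero_div]
    exact expect_nonneg fun _ _ => Real.sqrt_nonneg _
  set l := √(2 * K * m) with hl
  have hlpos : 0 < l := Real.sqrt_pos.2 (by positivity)
  have hl2 : l ^ 2 = 2 * K * m := Real.sq_sqrt (by positivity)
  -- A quadratic minorant of the square root. With l² = 2 K m, the moment hypothesis bounds its mean
  -- below by m/l - m/(2l) = m/(2l).
  have hpt : ∀ x, Y x / l - Y x ^ 2 / l ^ 3 ≤ √(Y x) := by
    intro x
    set u := √(Y x) with hu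
    have hu0 : 0 ≤ u := Real.sqrt_nonneg _
    have hu2 : Y x = u ^ 2 := (Real.sq_sqrt (hY x)).symm
    rw [hu2, div_sub_div _ _ hlpos.ne' (by positivity), div_le_iff₀ (by positivity)]
    have h3 : 0 ≤ u * (l ^ 3 - u * l ^ 2 + u ^ 3) := by
      refine mul_nonneg hu0 ?_
      rcases le_total u l with hul | hul
      · have := mul_nonneg (sub_nonneg.2 hul) (sq_nonneg l)
        have h4 : 0 ≤ u ^ 3 := by positivity
        nlinarith
      · have h5 : u * l ^ 2 ≤ u * u ^ 2 := by gcongr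
        have h4 : 0 ≤ l ^ 3 := by positivity
        nlinarith
    nlinarith [mul_nonneg h3 hlpos.le]
  have h1 : m / l - (K * m ^ 2) / l ^ 3 ≤ 𝔼 x, √(Y x) := by
    calc m / l - (K * m ^ 2) / l ^ 3 ≤ m / l - (𝔼 x, Y x ^ 2) / l ^ 3 := by gcongr
      _ = 𝔼 x, (Y x / l - Y x ^ 2 / l ^ 3) := by
        rw [expect_sub_distrib, expect_div, expect_div]
      _ ≤ _ := expect_le_expect fun x _ => hpt x
  refine le_trans (le_of_eq ?_) h1
  have hml : l = √(2 * K) * √m := by rw [hl, Real.sqrt_mul (by positivity)]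
  have ha : K * m ^ 2 / l ^ 3 = m / (2 * l) := by
    rw [show l ^ 3 = 2 * K * m * l by rw [← hl2]; ring]
    field_simp
  have hs : √m * √m = m := Real.mul_self_sqrt hm0
  have hsm : 0 < √m := Real.sqrt_pos.2 hpos
  have hsk : 0 < √(2 * K) := Real.sqrt_pos.2 (by positivity)
  rw [ha, hml]
  field_simp
  nlinarith

/-- By Cauchy–Schwarz each mixed moment of Q r² and Q r'² is at most K times the product of the
second moments. The fourth moment bound thus passes from matrix entries to the Frobenius norm with
the same constant. -/
theorem expect_sum_sq_sq_le {R : Type*} (s : Finset R) (Q : R → (ι → ℤˣ) → ℝ) {K : ℝ}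
    (hK : 0 ≤ K) (h : ∀ r ∈ s, 𝔼 x, Q r x ^ 4 ≤ K * (𝔼 x, Q r x ^ 2) ^ 2) :
    𝔼 x, (∑ r ∈ s, Q r x ^ 2) ^ 2 ≤ K * (𝔼 x, ∑ r ∈ s, Q r x ^ 2) ^ 2 := by
  have h0 : ∀ r, 0 ≤ 𝔼 x, Q r x ^ 2 := fun r => expect_nonneg fun _ _ => by positivity
  have h1 : ∀ r ∈ s, ∀ r' ∈ s, 𝔼 x, Q r x ^ 2 * Q r' x ^ 2 ≤
      K * ((𝔼 x, Q r x ^ 2) * 𝔼 x, Q r' x ^ 2) := by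
    intro r hr r' hr'
    have h1 := expect_mul_sq_le_sq_mul_sq univ (fun x => Q r x ^ 2) fun x => Q r' x ^ 2
    simp only [← pow_mul] at h1
    refine le_of_sq_le_sq (h1.trans ?_) (mul_nonneg hK (mul_nonneg (h0 _) (h0 _)))
    refine (mul_le_mul (h r hr) (h r' hr') (expect_nonneg fun _ _ => by positivity)
      (by positivity)).trans (le_of_eq ?_)
    ring
  have h2 : ∀ x, (∑ r ∈ s, Q r x ^ 2) ^ 2 = ∑ r ∈ s, ∑ r' ∈ s, Q r x ^ 2 * Q r' x ^ 2 := fun x => by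
    rw [sq, sum_mul_sum]
  simp only [h2, expect_sum_comm]
  rw [sq, sum_mul_sum, mul_sum]
  simp only [mul_sum]
  exact sum_le_sum fun r hr => sum_le_sum fun r' hr' => h1 r hr r' hr'

end Hypercontractivity

/-! ### The separator inequality for a single time -/

namespace Shape

section Combinatorics

variable {V : Type*} [Fintype V] [DecidableEq V] (α : Shape V)

theorem mem_isolatedMiddle {a : V} :
    a ∈ α.isolatedMiddle ↔ ¬ (a ∈ α.left ∨ a ∈ α.right) ∧ ∀ b, ¬ α.graph.Adj a b := by
  classical
  rw [isolatedMiddle, mem_filter, middle]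
  simp [SimpleGraph.IsIsolated]

omit [Fintype V] [DecidableEq V] in
theorem minSeparatorCard_le {S : Finset V} (hS : α.IsVertexSeparator S) :
    α.minSeparatorCard ≤ S.card :=
  Nat.sInf_le ⟨S, hS, rfl⟩

omit [DecidableEq V] in
theorem minSeparatorCard_le_card : α.minSeparatorCard ≤ Fintype.card V := by
  obtain ⟨S, -, hS⟩ := α.exists_separator_card_eq
  exact hS ▸ card_le_univ S

-- A walk staying inside F ∪ G would start in G, could never step from G into F, and so would also
-- end in G.
omit [Fintype V] [DecidableEq V] in
theorem exists_mem_support_notMem {F G : Finset V}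
    (hFG : ∀ a b, α.graph.Adj a b → a ∈ F → b ∉ G) {u v : V} (p : α.graph.Walk u v)
    (hu : u ∉ F) (hv : v ∉ G) : ∃ x ∈ p.support, x ∉ F ∧ x ∉ G := by
  induction p with
  | nil => exact ⟨_, by simp, hu, hv⟩
  | @cons a b c h p ih =>
    by_cases ha : a ∈ G
    · obtain ⟨x, hx, hx'⟩ := ih (fun hb => hFG _ _ h.symm hb ha) hv
      exact ⟨x, by simp [hx], hx'⟩
    · exact ⟨a, by simp, hu, ha⟩

/-- The complement of F ∪ G is a separator and F ∩ G lies in the isolated middle, so |F| + |G| = |F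
∪ G| + |F ∩ G| gives the bound. The two cases of `hside` are the two directions in which a sequence
of realizations crosses the shape. -/
theorem card_add_card_add_minSeparatorCard_le {F G : Finset V}
    (hFG : ∀ a b, α.graph.Adj a b → a ∈ F → b ∉ G)
    (hside : ((∀ u ∈ α.left, u ∉ F) ∧ ∀ v ∈ α.right, v ∉ G) ∨
      ((∀ u ∈ α.left, u ∉ G) ∧ ∀ v ∈ α.right, v ∉ F))
    (hiso : ∀ a ∈ F, a ∈ G → ∀ b, ¬ α.graph.Adj a b) :
    F.card + G.card + α.minSeparatorCard ≤ Fintype.card V + α.isolatedMiddle.card := by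
  classical
  have hsep : α.IsVertexSeparator (univ \ (F ∪ G)) := by
    intro u hu v hv p _
    rcases hside with ⟨h1, h2⟩ | ⟨h1, h2⟩
    · obtain ⟨x, hx, hx1, hx2⟩ := α.exists_mem_support_notMem hFG p (h1 u hu) (h2 v hv)
      exact ⟨x, hx, by simp [hx1, hx2]⟩
    · obtain ⟨x, hx, hx1, hx2⟩ := α.exists_mem_support_notMem
        (fun a b hab ha hb => hFG b a hab.symm hb ha) p (h1 u hu) (h2 v hv)
      exact ⟨x, hx, by simp [hx1, hx2]⟩
  have h1 := α.minSeparatorCard_le hsep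
  rw [card_sdiff_of_subset (subset_univ _), card_univ] at h1
  have h2 := card_union_add_card_inter F G
  have h3 : (F ∪ G).card ≤ Fintype.card V := card_le_univ _
  have h4 : (F ∩ G).card ≤ α.isolatedMiddle.card := by
    refine card_le_card fun a ha => ?_
    rw [mem_inter] at ha
    refine α.mem_isolatedMiddle.2 ⟨?_, hiso a ha.1 ha.2⟩
    rintro (h | h)
    · rcases hside with ⟨h1, h2⟩ | ⟨h1, h2⟩
      exacts [h1 a h ha.1, h1 a h ha.2]
    · rcases hside with ⟨h1, h2⟩ | ⟨h1, h2⟩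
      exacts [h2 a h ha.2, h2 a h ha.1]
  omega

end Combinatorics

/-! ### Number of distinct labels in a repeated chain -/

section Labels

variable {V T : Type*} [Fintype V] [Fintype T] {n : ℕ}

open Classical in
/-- The vertices whose label at time `t` does not occur at any time related to `t`. -/
noncomputable def freshVertices (lt : T → T → Prop) (φ : T → V ↪ Fin n) (t : T) : Finset V :=
  univ.filter fun a => ∀ t', lt t' t → φ t a ∉ Set.range (φ t')

theorem mem_freshVertices {lt : T → T → Prop} {φ : T → V ↪ Fin n} {t : T} {a : V} :
    a ∈ freshVertices lt φ t ↔ ∀ t', lt t' t → φ t a ∉ Set.range (φ t') := by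
  simp [freshVertices]

/-- All labels occurring in a family of labellings. -/
def labels (φ : T → V ↪ Fin n) : Finset (Fin n) := univ.image fun p : T × V => φ p.1 p.2

/-- Each label is charged to a minimal time of occurrence. The relation is left general so that it
can be "earlier" (first occurrences) or "later" (last occurrences). -/
theorem card_labels_le_sum_fresh (lt : T → T → Prop) (hlt : WellFounded lt)
    (φ : T → V ↪ Fin n) : (labels φ).card ≤ ∑ t, (freshVertices lt φ t).card := by
  classical
  have h : labels φ ⊆ univ.biUnion fun t => (freshVertices lt φ t).image (φ t) := by
    intro l hl
    simp only [labels, mem_image, mem_univ, true_and, Prod.exists] at hl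
    have hne : {t | l ∈ Set.range (φ t)}.Nonempty := by
      obtain ⟨t, a, h⟩ := hl
      exact ⟨t, a, h⟩
    obtain ⟨a, ha⟩ := hlt.min_mem _ hne
    simp only [mem_biUnion, mem_univ, true_and, mem_image]
    refine ⟨_, a, mem_freshVertices.2 fun t' ht' hmem => ?_, ha⟩
    rw [ha] at hmem
    exact hlt.not_lt_min _ hmem ht'
  exact (card_le_card h).trans (card_biUnion_le.trans (sum_le_sum fun t _ => card_image_le))

/-- A sequence of `2 q` labellings which agree alternatingly on the right and on the left
vertices, such that the labels of every edge occur together at another time. -/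
structure IsRepeatedChain (α : Shape V) {q : ℕ} (p : Fin q × Bool → V ↪ Fin n) : Prop where
  right_eq : ∀ j, ∀ v ∈ α.right, p (j, false) v = p (j, true) v
  left_eq : ∀ j j' : Fin q, (j' : ℕ) = j + 1 → ∀ u ∈ α.left, p (j, true) u = p (j', false) u
  exists_ne : ∀ t a b, α.graph.Adj a b →
    ∃ t' ≠ t, p t a ∈ Set.range (p t') ∧ p t b ∈ Set.range (p t')

/-- The position of a labelling in the sequence. -/
def timeRank {q : ℕ} (t : Fin q × Bool) : ℕ := 2 * t.1 + t.2.toNat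

theorem timeRank_injective {q : ℕ} : Function.Injective (timeRank (q := q)) := by
  rintro ⟨j, b⟩ ⟨j', b'⟩ h
  simp only [timeRank] at h
  cases b <;> cases b' <;> simp at h <;> simp [Fin.ext_iff] <;> omega

/-- The first and the last position. -/
def isBoundary {q : ℕ} (t : Fin q × Bool) : Prop :=
  (t.2 = false ∧ (t.1 : ℕ) = 0) ∨ (t.2 = true ∧ (t.1 : ℕ) + 1 = q)

open Classical in
theorem sum_isBoundary_le (q : ℕ) (c : ℕ) :
    ∑ t : Fin q × Bool, (if isBoundary t then c else 0) ≤ 2 * c := by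
  rw [Fintype.sum_prod_type_right]
  simp only [Fintype.sum_bool, isBoundary]
  simp only [Bool.true_eq_false, false_and, true_and, false_or, Bool.false_eq_true, or_false]
  have : ∀ (P : Fin q → Prop) [DecidablePred P], (∀ i j, P i → P j → i = j) → ∑ i, (if P i then c else 0) ≤ c := by
    intro P _ hP
    rw [← sum_filter, sum_const, smul_eq_mul]
    refine (Nat.mul_le_mul_right c (card_le_one.2 fun i hi j hj => ?_)).trans (one_mul c).le
    exact hP _ _ (mem_filter.1 hi).2 (mem_filter.1 hj).2
  have h1 := this (fun i => (i : ℕ) + 1 = q) fun i j hi hj => Fin.ext (by omega)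
  have h2 := this (fun i => (i : ℕ) = 0) fun i j hi hj => Fin.ext (by omega)
  omega

variable [DecidableEq V]

/-- The two sets hold the first and the last occurrences at `t`. The other time carrying both labels
of an edge is either earlier, so neither label is new, or later, so neither is seen for the last
time. Away from the boundary `t` has neighbors on both sides, one sharing the left labels and the
other the right labels. -/
theorem IsRepeatedChain.fresh_add_fresh_le {α : Shape V} {q : ℕ} {p : Fin q × Bool → V ↪ Fin n}
    (h : α.IsRepeatedChain p) (t : Fin q × Bool) (ht : ¬ isBoundary t) :
    (freshVertices (fun t' t => timeRank t' < timeRank t) p t).card +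
      (freshVertices (fun t' t => timeRank t < timeRank t') p t).card + α.minSeparatorCard ≤
        Fintype.card V + α.isolatedMiddle.card := by
  apply α.card_add_card_add_minSeparatorCard_le
  · intro a b hab ha hb
    rw [mem_freshVertices] at ha hb
    obtain ⟨t', ht', h1, h2⟩ := h.exists_ne t a b hab
    rcases lt_trichotomy (timeRank t') (timeRank t) with h3 | h3 | h3
    · exact ha t' h3 h1
    · exact ht' (timeRank_injective h3)
    · exact hb t' h3 h2
  · obtain ⟨j, b⟩ := t
    cases b
    · left
      refine ⟨fun u hu hF => ?_, fun v hv hG => ?_⟩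
      · have hj : (j : ℕ) ≠ 0 := fun hj => ht (Or.inl ⟨rfl, hj⟩)
        refine mem_freshVertices.1 hF (⟨j - 1, by omega⟩, true) ?_
          ⟨u, h.left_eq _ _ ?_ u hu⟩ <;> simp [timeRank] <;> omega
      · exact mem_freshVertices.1 hG (j, true) (by simp [timeRank]) ⟨v, (h.right_eq j v hv).symm⟩
    · right
      refine ⟨fun u hu hG => ?_, fun v hv hF => ?_⟩
      · have hj : (j : ℕ) + 1 ≠ q := fun hj => ht (Or.inr ⟨rfl, hj⟩)
        refine mem_freshVertices.1 hG (⟨j + 1, by omega⟩, false) ?_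
          ⟨u, (h.left_eq _ _ ?_ u hu).symm⟩ <;> simp [timeRank]; omega
      · exact mem_freshVertices.1 hF (j, false) (by simp [timeRank]) ⟨v, h.right_eq j v hv⟩
  · intro a ha ha' b hab
    rw [mem_freshVertices] at ha ha'
    obtain ⟨t', ht', h1, -⟩ := h.exists_ne t a b hab
    rcases lt_trichotomy (timeRank t') (timeRank t) with h3 | h3 | h3
    · exact ha t' h3 h1
    · exact ht' (timeRank_injective h3)
    · exact ha' t' h3 h1

/-- First and last occurrences both count every label, so summing over the 2q times bounds twice the
number of labels. The two boundary times are bounded trivially, at a total cost of 4|V|, which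
halving turns into 2|V|. -/
theorem IsRepeatedChain.card_labels_add_le {α : Shape V} {q : ℕ} {p : Fin q × Bool → V ↪ Fin n}
    (h : α.IsRepeatedChain p) :
    (labels p).card + q * α.minSeparatorCard ≤
      q * (Fintype.card V + α.isolatedMiddle.card) + 2 * Fintype.card V := by
  classical
  have h1 := card_labels_le_sum_fresh (fun t' t => timeRank t' < timeRank t)
    (InvImage.wf timeRank wellFounded_lt) p
  have h2 := card_labels_le_sum_fresh (fun t' t => timeRank t < timeRank t')
    (Finite.wellFounded_of_trans_of_irrefl (r := fun t' t : Fin q × Bool => timeRank t < timeRank t')) p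
  have h3 : ∑ t, ((freshVertices (fun t' t => timeRank t' < timeRank t) p t).card +
      (freshVertices (fun t' t => timeRank t < timeRank t') p t).card + α.minSeparatorCard) ≤
      ∑ t : Fin q × Bool, (Fintype.card V + α.isolatedMiddle.card +
        if isBoundary t then 2 * Fintype.card V else 0) := by
    refine sum_le_sum fun t _ => ?_
    split_ifs with hb
    · have := α.minSeparatorCard_le_card
      have h4 : ∀ F : Finset V, F.card ≤ Fintype.card V := card_le_univ
      have h5 := h4 (freshVertices (fun t' t => timeRank t' < timeRank t) p t)
      have h6 := h4 (freshVertices (fun t' t => timeRank t < timeRank t') p t)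
      omega
    · exact h.fresh_add_fresh_le t hb
  have h4 := sum_isBoundary_le q (2 * Fintype.card V)
  simp only [sum_add_distrib, sum_const, card_univ, Fintype.card_prod, Fintype.card_fin,
    Fintype.card_bool, smul_eq_mul] at h3
  nlinarith

end Labels

end Shape

/-! ### Weighted count of label assignments by their number of distinct labels -/

theorem sum_fin_pow_card_image_le (n : ℕ) {μ : ℝ} (hμ : 0 ≤ μ) (K T : ℕ) (hT : T ≤ K) :
    ∑ g : Fin T → Fin n, μ ^ (univ.image g).card ≤ (n * μ + K) ^ T := by
  induction T with
  | zero => simp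
  | succ T ih =>
    rw [← (Fin.consEquiv fun _ => Fin n).sum_comp, Fintype.sum_prod_type_right]
    have h1 : ∀ (g : Fin T → Fin n) (l : Fin n), univ.image ((Fin.consEquiv fun _ => Fin n) (l, g)) =
        insert l (univ.image g) := by
      intro g l
      ext x
      simp [Fin.exists_fin_succ, eq_comm]
    -- An added label is either new, with weight μ, or one of at most K labels already used, with
    -- weight 1.
    have h2 : ∀ g : Fin T → Fin n,
        ∑ l, μ ^ (univ.image ((Fin.consEquiv fun _ => Fin n) (l, g))).card ≤
          μ ^ (univ.image g).card * (n * μ + K) := by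
      intro g
      calc _ ≤ ∑ l : Fin n, μ ^ (univ.image g).card * (μ + if l ∈ univ.image g then 1 else 0) := by
            refine sum_le_sum fun l _ => ?_
            rw [h1]
            split_ifs with h
            · rw [insert_eq_of_mem h]
              exact le_mul_of_one_le_right (by positivity) (by linarith)
            · rw [card_insert_of_notMem h, pow_succ, add_zero]
        _ = μ ^ (univ.image g).card * (n * μ + (univ.image g).card) := by
            rw [← mul_sum, sum_add_distrib]
            simp
        _ ≤ _ := by
            have : (univ.image g).card ≤ K := card_image_le.trans (by simp; omega)
            gcongr
    calc _ ≤ ∑ g : Fin T → Fin n, μ ^ (univ.image g).card * (n * μ + K) :=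
          sum_le_sum fun g _ => h2 g
      _ ≤ (n * μ + K) ^ T * (n * μ + K) := by
          rw [← sum_mul]
          gcongr
          exact ih (by omega)
      _ = _ := (pow_succ _ _).symm

/-- The generating function of the number of distinct labels of a family of labels. -/
theorem sum_pow_card_image_le {I : Type*} [Fintype I] [DecidableEq I] (n : ℕ) {μ : ℝ} (hμ : 0 ≤ μ)
    (K : ℕ) (hK : Fintype.card I ≤ K) :
    ∑ g : I → Fin n, μ ^ (univ.image g).card ≤ (n * μ + K) ^ Fintype.card I := by
  refine le_trans (le_of_eq ?_) (sum_fin_pow_card_image_le n hμ K _ hK)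
  refine Fintype.sum_equiv ((Fintype.equivFin I).arrowCongr (Equiv.refl _)) _ _ fun g => ?_
  congr 2
  ext x
  simp only [mem_image, mem_univ, true_and, Equiv.arrowCongr_apply, Equiv.coe_refl,
    Function.comp_apply, id]
  exact ⟨fun ⟨i, h⟩ => ⟨Fintype.equivFin I i, by simpa using h⟩, fun ⟨i, h⟩ => ⟨_, h⟩⟩

/-! ### Counting repeated chains -/

namespace Shape

variable {V : Type*} [Fintype V] [DecidableEq V] (α : Shape V)

/-- The vertices whose labels are determined by the previous labelling. -/
def boundSide {q : ℕ} (t : Fin q × Bool) : Finset V :=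
  if t.2 = true then α.right else if (t.1 : ℕ) = 0 then ∅ else α.left

/-- The positions whose labels are not determined by the previous labelling. -/
abbrev FreeSlot (q : ℕ) : Type _ := {s : (Fin q × Bool) × V // s.2 ∉ α.boundSide s.1}

theorem card_freeSlot_le_mul (q : ℕ) : Fintype.card (α.FreeSlot q) ≤ 2 * q * Fintype.card V := by
  refine (Fintype.card_subtype_le _).trans (le_of_eq ?_)
  simp only [Fintype.card_prod, Fintype.card_fin, Fintype.card_bool]
  ring

theorem card_freeSlot_le (q : ℕ) : Fintype.card (α.FreeSlot q) ≤
    q * (2 * Fintype.card V - α.left.card - α.right.card) + Fintype.card V := by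
  have h1 : Fintype.card (α.FreeSlot q) =
      ∑ t : Fin q × Bool, (Fintype.card V - (α.boundSide t).card) := by
    rw [Fintype.card_subtype, card_filter, Fintype.sum_prod_type]
    refine sum_congr rfl fun t _ => ?_
    rw [← card_filter, ← card_univ, ← card_sdiff_of_subset (subset_univ _)]
    congr 1
    ext; simp
  have h2 : ∀ j : Fin q, Fintype.card V - (α.boundSide (j, true)).card +
      (Fintype.card V - (α.boundSide (j, false)).card) ≤
      (2 * Fintype.card V - α.left.card - α.right.card) +
        if (j : ℕ) = 0 then Fintype.card V else 0 := by
    intro j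
    have h3 := card_le_univ α.left
    have h4 := card_le_univ α.right
    by_cases hj : (j : ℕ) = 0
    · simp only [boundSide, hj, if_true, card_empty, Bool.false_eq_true, if_false]
      omega
    · simp only [boundSide, hj, if_true, Bool.false_eq_true, if_false]
      omega
  rw [h1, Fintype.sum_prod_type]
  simp only [Fintype.sum_bool]
  refine (sum_le_sum fun j _ => h2 j).trans ?_
  rw [sum_add_distrib, sum_const, card_univ, Fintype.card_fin, smul_eq_mul]
  gcongr
  rw [← sum_filter, sum_const, smul_eq_mul]
  refine (Nat.mul_le_mul_right _ (card_le_one.2 fun i hi j hj => ?_)).trans (one_mul _).le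
  exact Fin.ext ((mem_filter.1 hi).2.trans (mem_filter.1 hj).2.symm)

-- Induction on time: a slot that is not free copies its label from the preceding realization.
omit [Fintype V] in
theorem IsRepeatedChain.ext_of_freeSlot {α : Shape V} {n q : ℕ}
    {p p' : Fin q × Bool → V ↪ Fin n} (h : α.IsRepeatedChain p) (h' : α.IsRepeatedChain p')
    (hs : ∀ s : α.FreeSlot q, p s.1.1 s.1.2 = p' s.1.1 s.1.2) : p = p' := by
  have key : ∀ N, ∀ t, timeRank t = N → p t = p' t := by
    intro N
    induction N using Nat.strong_induction_on with
    | _ N ih =>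
      rintro ⟨j, b⟩ rfl
      ext1 a
      by_cases ha : a ∈ α.boundSide (j, b)
      · cases b
        · have hj : (j : ℕ) ≠ 0 := fun hj => by simp [boundSide, hj] at ha
          have ha : a ∈ α.left := by simpa [boundSide, hj] using ha
          have h1 : (j : ℕ) = (⟨j - 1, by omega⟩ : Fin q) + 1 := by simp; omega
          rw [← h.left_eq _ _ h1 a ha, ← h'.left_eq _ _ h1 a ha,
            ih _ (by simp [timeRank]; omega) _ rfl]
        · have ha : a ∈ α.right := by simpa [boundSide] using ha
          rw [← h.right_eq _ a ha, ← h'.right_eq _ a ha, ih _ (by simp [timeRank]) _ rfl]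
      · exact hs ⟨((j, b), a), ha⟩
  exact funext fun t => key _ t rfl

-- A chain uses at most `Nmax` labels and n/q ≥ 1, so each chain has weight at least 1 under
-- (n/q)^Nmax (q/n)^(number of labels). The weighted sum may then run over all assignments to the
-- free slots. The choice μ = q/n makes the base n μ + 2q|V| a constant multiple of q.
open Classical in
theorem card_isRepeatedChain_le {n q : ℕ} (hq : 1 ≤ q) (hqn : q ≤ n) :
    ((univ.filter fun p : Fin q × Bool → V ↪ Fin n => α.IsRepeatedChain p).card : ℝ) ≤
      ((n : ℝ) / q) ^ (q * (Fintype.card V + α.isolatedMiddle.card - α.minSeparatorCard) +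
        2 * Fintype.card V) *
      ((1 + 2 * Fintype.card V) * q) ^
        (q * (2 * Fintype.card V - α.left.card - α.right.card) + Fintype.card V) := by
  set Nmax := q * (Fintype.card V + α.isolatedMiddle.card - α.minSeparatorCard) +
    2 * Fintype.card V with hN
  have hq0 : (0 : ℝ) < q := by exact_mod_cast hq
  have hn0 : (0 : ℝ) < n := by exact_mod_cast hq.trans hqn
  set r : (Fin q × Bool → V ↪ Fin n) → α.FreeSlot q → Fin n := fun p s => p s.1.1 s.1.2 with hr
  have hlam : (1 : ℝ) ≤ n / q := by rw [one_le_div hq0]; exact_mod_cast hqn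
  have hcard : ∀ p, α.IsRepeatedChain p → (univ.image (r p)).card ≤ Nmax := by
    intro p hp
    have h1 : (univ.image (r p)).card ≤ (labels p).card := by
      refine card_le_card fun l hl => ?_
      obtain ⟨s, -, rfl⟩ := mem_image.1 hl
      exact mem_image.2 ⟨s.1, mem_univ _, rfl⟩
    have h2 := hp.card_labels_add_le
    rw [hN, Nat.mul_sub]
    omega
  have hterm : ∀ p, α.IsRepeatedChain p →
      (1 : ℝ) ≤ (n / q : ℝ) ^ Nmax * ((q : ℝ) / n) ^ (univ.image (r p)).card := by
    intro p hp
    rw [← Nat.sub_add_cancel (hcard p hp), pow_add, mul_assoc, ← mul_pow]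
    rw [div_mul_div_cancel₀ hq0.ne', div_self hn0.ne', one_pow, mul_one]
    exact one_le_pow₀ hlam
  have hone : (1 : ℝ) ≤ (1 + 2 * Fintype.card V) * q := by
    have : (1 : ℝ) ≤ q := by exact_mod_cast hq
    nlinarith [(Nat.cast_nonneg (Fintype.card V) : (0 : ℝ) ≤ _)]
  calc ((univ.filter fun p : Fin q × Bool → V ↪ Fin n => α.IsRepeatedChain p).card : ℝ)
      = ∑ p ∈ univ.filter fun p : Fin q × Bool → V ↪ Fin n => α.IsRepeatedChain p, (1 : ℝ) := by
        simp
    _ ≤ ∑ p ∈ univ.filter fun p : Fin q × Bool → V ↪ Fin n => α.IsRepeatedChain p,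
          (n / q : ℝ) ^ Nmax * ((q : ℝ) / n) ^ (univ.image (r p)).card :=
        sum_le_sum fun p hp => hterm p (mem_filter.1 hp).2
    _ = (n / q : ℝ) ^ Nmax * ∑ g ∈ (univ.filter fun p : Fin q × Bool → V ↪ Fin n =>
          α.IsRepeatedChain p).image r, ((q : ℝ) / n) ^ (univ.image g).card := by
        rw [← mul_sum, sum_image]
        intro p hp p' hp' h
        exact (mem_filter.1 hp).2.ext_of_freeSlot (mem_filter.1 hp').2 fun s => congrFun h s
    _ ≤ (n / q : ℝ) ^ Nmax * ∑ g, ((q : ℝ) / n) ^ (univ.image g).card := by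
        gcongr
        exact subset_univ _
    _ ≤ (n / q : ℝ) ^ Nmax * (n * ((q : ℝ) / n) + (2 * q * Fintype.card V : ℕ)) ^
          Fintype.card (α.FreeSlot q) := by
        gcongr
        exact sum_pow_card_image_le n (by positivity) _ (α.card_freeSlot_le_mul q)
    _ = (n / q : ℝ) ^ Nmax * ((1 + 2 * Fintype.card V) * q) ^ Fintype.card (α.FreeSlot q) := by
        congr 2
        rw [mul_div_cancel₀ _ hn0.ne']
        push_cast
        ring
    _ ≤ _ := by
        gcongr
        exact α.card_freeSlot_le q

end Shape

/-! ### Matrix powers as sums over walks -/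

section MatrixPower

variable {m : Type*} [Fintype m] [DecidableEq m]

theorem Matrix.pow_apply_eq_sum (A : Matrix m m ℝ) (q : ℕ) (i j : m) :
    (A ^ q) i j = ∑ b : Fin (q + 1) → m, if b 0 = i ∧ b (Fin.last q) = j then
      ∏ t : Fin q, A (b t.castSucc) (b t.succ) else 0 := by
  induction q generalizing i with
  | zero =>
    rw [pow_zero, ← (Equiv.funUnique (Fin 1) m).symm.sum_comp]
    simp only [Matrix.one_apply, univ_eq_empty, prod_empty]
    by_cases h : i = j
    · subst h
      simp [Equiv.funUnique]
    · rw [if_neg h, sum_eq_zero]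
      intro x _
      rw [if_neg]
      rintro ⟨rfl, h2⟩
      exact h h2
  | succ q ih =>
    rw [pow_succ', Matrix.mul_apply, ← (Fin.consEquiv fun _ => m).sum_comp, Fintype.sum_prod_type]
    simp only [Fin.consEquiv_apply, Fin.prod_univ_succ, Fin.castSucc_zero, Fin.cons_zero,
      Fin.cons_succ, ← Fin.succ_last, ← Fin.succ_castSucc]
    have h1 : ∀ (l : m) (b : Fin (q + 1) → m), (if l = i ∧ b (Fin.last q) = j then
        A l (b 0) * ∏ t : Fin q, A (b t.castSucc) (b t.succ) else 0) = if l = i then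
          (if b (Fin.last q) = j then
            A l (b 0) * ∏ t : Fin q, A (b t.castSucc) (b t.succ) else 0) else 0 := fun l b => by
      rw [ite_and]
    rw [sum_comm]
    simp only [h1, Finset.sum_ite_eq', mem_univ, if_true, ih, mul_sum]
    rw [sum_comm]
    refine sum_congr rfl fun b _ => ?_
    simp only [ite_and, mul_ite, mul_zero]
    rw [Finset.sum_ite_eq]
    simp

theorem Matrix.trace_pow_eq_sum (A : Matrix m m ℝ) (q : ℕ) :
    (A ^ q).trace = ∑ b : Fin (q + 1) → m, if b 0 = b (Fin.last q) then
      ∏ t : Fin q, A (b t.castSucc) (b t.succ) else 0 := by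
  simp only [Matrix.trace, Matrix.diag_apply, Matrix.pow_apply_eq_sum]
  rw [sum_comm]
  refine sum_congr rfl fun b _ => ?_
  simp only [ite_and]
  rw [Finset.sum_ite_eq]
  simp [eq_comm]

end MatrixPower

/-! ### Expansion of the trace into chains of realizations -/

namespace Shape

variable {V : Type*} [Fintype V] (α : Shape V) {n : ℕ}

open Classical in
/-- The product of the edge variables over a realization of the shape. -/
noncomputable def monomial (φ : V ↪ Fin n) (x : (⊤ : SimpleGraph (Fin n)).edgeSet → ℝ) : ℝ :=
  ∏ e : α.graph.edgeSet, x (α.mapEdge φ e)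

/-- The row index of a realization. -/
def rowOf (φ : V ↪ Fin n) : α.left → Fin n := fun u => φ u

/-- The column index of a realization. -/
def colOf (φ : V ↪ Fin n) : α.right → Fin n := fun v => φ v

theorem graphMatrix_apply (x : (⊤ : SimpleGraph (Fin n)).edgeSet → ℝ) (r : α.left → Fin n)
    (c : α.right → Fin n) : α.graphMatrix n x r c =
      ∑ φ : V ↪ Fin n, if α.rowOf φ = r ∧ α.colOf φ = c then α.monomial φ x else 0 := by
  classical
  rw [graphMatrix, Matrix.sum_apply]
  refine sum_congr rfl fun φ _ => ?_
  simp only [Matrix.single_apply]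
  rfl

theorem mul_transpose_apply [DecidableEq V] (x : (⊤ : SimpleGraph (Fin n)).edgeSet → ℝ)
    (r r' : α.left → Fin n) :
    (α.graphMatrix n x * (α.graphMatrix n x).transpose) r r' =
      ∑ w : (V ↪ Fin n) × (V ↪ Fin n),
        if α.rowOf w.1 = r ∧ α.rowOf w.2 = r' ∧ α.colOf w.1 = α.colOf w.2 then
          α.monomial w.1 x * α.monomial w.2 x else 0 := by
  simp only [Matrix.mul_apply, Matrix.transpose_apply, graphMatrix_apply, sum_mul_sum]
  rw [sum_comm, Fintype.sum_prod_type]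
  refine sum_congr rfl fun φ _ => ?_
  rw [sum_comm]
  refine sum_congr rfl fun ψ _ => ?_
  rw [sum_eq_single (α.colOf φ)]
  · by_cases h1 : α.rowOf φ = r <;> by_cases h2 : α.rowOf ψ = r' <;>
      by_cases h3 : α.colOf φ = α.colOf ψ <;> simp [h1, h2, h3, eq_comm (a := α.colOf ψ)]
  · intro c _ hc
    simp [hc.symm]
  · simp

/-- The sequence of realizations underlying a sequence of pairs of realizations. -/
def unpair {q : ℕ} (p : Fin q → (V ↪ Fin n) × (V ↪ Fin n)) : Fin q × Bool → V ↪ Fin n :=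
  fun t => if t.2 = true then (p t.1).2 else (p t.1).1

omit [Fintype V] in
theorem unpair_injective {q : ℕ} : Function.Injective (unpair (V := V) (n := n) (q := q)) := by
  intro p p' h
  funext j
  have h1 := congrFun h (j, false)
  have h2 := congrFun h (j, true)
  simp only [unpair, Bool.false_eq_true, if_false, if_true] at h1 h2
  exact Prod.ext h1 h2

open Classical in
theorem prod_monomial_eq {q : ℕ} (p : Fin q → (V ↪ Fin n) × (V ↪ Fin n))
    (x : (⊤ : SimpleGraph (Fin n)).edgeSet → ℝ) :
    ∏ j, (α.monomial (p j).1 x * α.monomial (p j).2 x) =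
      ∏ s : (Fin q × Bool) × α.graph.edgeSet, x (α.mapEdge (unpair p s.1) s.2) := by
  rw [Fintype.prod_prod_type, Fintype.prod_prod_type]
  refine prod_congr rfl fun j _ => ?_
  rw [Fintype.prod_bool, mul_comm]
  simp [unpair, monomial]

omit [Fintype V] in
theorem mapEdge_injective (φ : V ↪ Fin n) : Function.Injective (α.mapEdge φ) := by
  intro e e' h
  have h1 : Sym2.map φ e = Sym2.map φ e' := congrArg Subtype.val h
  exact Subtype.ext (Sym2.map.injective φ.injective h1)

omit [Fintype V] in
theorem mem_range_of_mapEdge_eq {φ ψ : V ↪ Fin n} {e e' : α.graph.edgeSet}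
    (h : α.mapEdge ψ e' = α.mapEdge φ e) {a : V} (ha : a ∈ (e : Sym2 V)) :
    φ a ∈ Set.range ψ := by
  have h1 : Sym2.map ψ e' = Sym2.map φ e := congrArg Subtype.val h
  have h2 : φ a ∈ Sym2.map ψ (e' : Sym2 V) := h1 ▸ Sym2.mem_map.2 ⟨a, ha, rfl⟩
  obtain ⟨b, -, hb⟩ := Sym2.mem_map.1 h2
  exact ⟨b, hb⟩

-- Each product of monomials in the expanded trace has mean at most 1, and its mean vanishes unless
-- every edge variable is repeated. The surviving sequences of realizations are repeated chains.
open Classical in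
theorem expect_norm_pow_le [DecidableEq V] (k : ℕ) :
    𝔼 x, ‖α.graphMatrix n (signVal x)‖ ^ (2 * 2 ^ k) ≤
      (univ.filter fun p : Fin (2 ^ k) × Bool → V ↪ Fin n => α.IsRepeatedChain p).card := by
  set q := 2 ^ k with hq
  have hq1 : 0 < q := by positivity
  let Adm : (Fin (q + 1) → α.left → Fin n) → (Fin q → (V ↪ Fin n) × (V ↪ Fin n)) → Prop :=
    fun b p => ∀ t, α.rowOf (p t).1 = b t.castSucc ∧ α.rowOf (p t).2 = b t.succ ∧
      α.colOf (p t).1 = α.colOf (p t).2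
  let E : (Fin q → (V ↪ Fin n) × (V ↪ Fin n)) → ℝ := fun p =>
    𝔼 x : (⊤ : SimpleGraph (Fin n)).edgeSet → ℤˣ,
      ∏ s : (Fin q × Bool) × α.graph.edgeSet, signVal x (α.mapEdge (unpair p s.1) s.2)
  have h1 : ∀ x : (⊤ : SimpleGraph (Fin n)).edgeSet → ℤˣ,
      ‖α.graphMatrix n (signVal x)‖ ^ (2 * q) ≤ ∑ b : Fin (q + 1) → α.left → Fin n,
        ∑ p : Fin q → (V ↪ Fin n) × (V ↪ Fin n), if b 0 = b (Fin.last q) ∧ Adm b p then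
          ∏ s : (Fin q × Bool) × α.graph.edgeSet, signVal x (α.mapEdge (unpair p s.1) s.2)
            else 0 := by
    intro x
    refine (l2_opNorm_pow_le_trace _ k).trans (le_of_eq ?_)
    rw [Matrix.trace_pow_eq_sum]
    refine sum_congr rfl fun b _ => ?_
    simp only [mul_transpose_apply]
    rw [prod_univ_sum, Fintype.piFinset_univ]
    by_cases hb : b 0 = b (Fin.last q)
    · rw [if_pos hb]
      refine sum_congr rfl fun p _ => ?_
      by_cases hp : Adm b p
      · rw [if_pos ⟨hb, hp⟩, ← prod_monomial_eq]
        exact prod_congr rfl fun t _ => if_pos (hp t)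
      · rw [if_neg (fun h => hp h.2)]
        simp only [Adm, not_forall] at hp
        obtain ⟨t, ht⟩ := hp
        exact prod_eq_zero (mem_univ t) (if_neg ht)
    · rw [if_neg hb]
      exact (sum_eq_zero fun p _ => if_neg fun h => hb h.1).symm
  have h2 : ∀ b p, Adm b p → E p ≠ 0 → α.IsRepeatedChain (unpair p) := by
    intro b p hbp hE
    refine ⟨fun j v hv => ?_, fun j j' hj u hu => ?_, fun t a a' haa' => ?_⟩
    · exact congrFun (hbp j).2.2 ⟨v, hv⟩
    · have h3 : j.succ = j'.castSucc := by ext; simp [hj]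
      have h4 := (hbp j).2.1.trans ((congrArg b h3).trans (hbp j').1.symm)
      exact congrFun h4 ⟨u, hu⟩
    · obtain ⟨⟨t', e'⟩, -, hne, he⟩ := exists_ne_of_expect_prod_ne_zero univ
        (fun s : (Fin q × Bool) × α.graph.edgeSet => α.mapEdge (unpair p s.1) s.2) hE
        (t, ⟨s(a, a'), haa'⟩) (mem_univ _)
      refine ⟨t', ?_, α.mem_range_of_mapEdge_eq he (by simp), α.mem_range_of_mapEdge_eq he (by simp)⟩
      -- A single realization is injective on edges, so the repetition occurs at another time.
      rintro rfl
      exact hne (Prod.ext rfl (α.mapEdge_injective _ he))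
  calc 𝔼 x, ‖α.graphMatrix n (signVal x)‖ ^ (2 * q)
      ≤ 𝔼 x, ∑ b : Fin (q + 1) → α.left → Fin n,
        ∑ p : Fin q → (V ↪ Fin n) × (V ↪ Fin n), if b 0 = b (Fin.last q) ∧ Adm b p then
          ∏ s : (Fin q × Bool) × α.graph.edgeSet, signVal x (α.mapEdge (unpair p s.1) s.2)
            else 0 := expect_le_expect fun x _ => h1 x
    _ = ∑ b : Fin (q + 1) → α.left → Fin n,
        ∑ p : Fin q → (V ↪ Fin n) × (V ↪ Fin n),
          if b 0 = b (Fin.last q) ∧ Adm b p then E p else 0 := by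
        rw [expect_sum_comm]
        refine sum_congr rfl fun b _ => ?_
        rw [expect_sum_comm]
        refine sum_congr rfl fun p _ => ?_
        split_ifs <;> simp [E]
    -- The closing condition `b 0 = b (Fin.last q)` is dropped here. The count of open chains
    -- suffices.
    _ ≤ ∑ b : Fin (q + 1) → α.left → Fin n, ∑ p : Fin q → (V ↪ Fin n) × (V ↪ Fin n),
          if Adm b p ∧ E p ≠ 0 then (1 : ℝ) else 0 := by
        refine sum_le_sum fun b _ => sum_le_sum fun p _ => ?_
        by_cases hE : E p = 0
        · simp [hE]
        · have hE1 : E p ≤ 1 := expect_prod_signVal_le_one _ _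
          by_cases hA : Adm b p
          · rw [if_pos (show Adm b p ∧ E p ≠ 0 from ⟨hA, hE⟩)]
            split_ifs
            exacts [hE1, zero_le_one]
          · simp [hA]
    _ = ((univ.filter fun bp : (Fin (q + 1) → α.left → Fin n) ×
          (Fin q → (V ↪ Fin n) × (V ↪ Fin n)) => Adm bp.1 bp.2 ∧ E bp.2 ≠ 0).card : ℝ) := by
        rw [card_filter, Fintype.sum_prod_type]
        push_cast
        rfl
    _ ≤ _ := by
        -- The walk `b` consists of the row indices of the realizations in `p`, so `p` alone
        -- determines the pair.
        refine Nat.cast_le.2 (card_le_card_of_injOn (fun bp => unpair bp.2) ?_ ?_)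
        · intro bp hbp
          have hbp := (mem_filter.1 hbp).2
          simpa using h2 bp.1 bp.2 hbp.1 hbp.2
        · rintro ⟨b, p⟩ hb ⟨b', p'⟩ hb' h
          obtain rfl : p = p' := unpair_injective h
          have hb := (mem_filter.1 hb).2.1
          have hb' := (mem_filter.1 hb').2.1
          refine Prod.ext (funext fun i => ?_) rfl
          refine Fin.cases ?_ (fun t => ?_) i
          · have h0 : (0 : Fin (q + 1)) = (⟨0, hq1⟩ : Fin q).castSucc := rfl
            change b 0 = b' 0
            rw [h0]
            exact (hb _).1.symm.trans (hb' _).1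
          · exact (hb t).2.1.symm.trans (hb' t).2.1

end Shape

/-! ### The upper bound: choice of the moment and arithmetic -/

theorem exists_two_pow_between {x : ℝ} (hx : 1 / 2 < x) :
    ∃ k : ℕ, x ≤ (2 : ℝ) ^ k ∧ (2 : ℝ) ^ k ≤ 2 * x := by
  by_cases h1 : x ≤ 1
  · exact ⟨0, by simpa using h1, by simp; linarith⟩
  · push Not at h1
    obtain ⟨k, hk1, hk2⟩ := exists_nat_pow_near h1.le (one_lt_two : (1 : ℝ) < 2)
    exact ⟨k + 1, hk2.le, by rw [pow_succ]; linarith⟩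

theorem expect_pow_le {X : Type*} [Fintype X] [Nonempty X] (f : X → ℝ) (hf : ∀ x, 0 ≤ f x) (N : ℕ) :
    (𝔼 x, f x) ^ N ≤ 𝔼 x, f x ^ N := by
  have h := Real.pow_arith_mean_le_arith_mean_pow univ (fun _ : X => ((Fintype.card X : ℝ))⁻¹) f
    (fun _ _ => by positivity) (by simp) (fun x _ => hf x) N
  rw [← mul_sum, ← mul_sum] at h
  simpa [Fintype.expect_eq_sum_div_card, div_eq_inv_mul] using h

theorem sqrt_pow_eq_rpow {x : ℝ} (hx : 0 ≤ x) (m : ℕ) : √(x ^ m) = x ^ ((m : ℝ) / 2) := by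
  rw [Real.sqrt_eq_rpow, ← Real.rpow_natCast, ← Real.rpow_mul hx]
  ring_nf

namespace Shape

variable {V : Type*} [Fintype V] [DecidableEq V] (α : Shape V)

theorem card_middle_add : α.middle.card + α.left.card + α.right.card =
    Fintype.card V + (α.left ∩ α.right).card := by
  have h1 : α.middle.card + (α.left ∪ α.right).card = Fintype.card V := by
    rw [middle, card_sdiff_of_subset (subset_univ _), card_univ]
    exact Nat.sub_add_cancel (card_le_univ _)
  have h2 := card_union_add_card_inter α.left α.right
  omega

theorem isolatedMiddle_subset : α.isolatedMiddle ⊆ α.middle := by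
  classical
  exact filter_subset _ _

theorem card_inter_le_minSeparatorCard : (α.left ∩ α.right).card ≤ α.minSeparatorCard := by
  obtain ⟨S, hS, hc⟩ := α.exists_separator_card_eq
  rw [← hc]
  refine card_le_card fun u hu => ?_
  rw [mem_inter] at hu
  obtain ⟨x, hx, hxS⟩ := hS u hu.1 u hu.2 .nil .nil
  rw [SimpleGraph.Walk.support_nil, List.mem_singleton] at hx
  exact hx ▸ hxS

/-- The exponent of `n`, as a natural number. -/
noncomputable def natPolyExponent : ℕ :=
  Fintype.card V + α.isolatedMiddle.card - α.minSeparatorCard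

/-- The exponent of the logarithm, as a natural number. -/
noncomputable def natLogExponent : ℕ :=
  (α.minSeparatorCard - (α.left ∩ α.right).card) + (α.middle.card - α.isolatedMiddle.card)

theorem cast_natPolyExponent : (α.natPolyExponent : ℝ) = α.polyExponent := by
  have := α.minSeparatorCard_le_card
  rw [natPolyExponent, Nat.cast_sub (by omega), polyExponent]
  push_cast
  ring

theorem cast_natLogExponent : (α.natLogExponent : ℝ) = α.logExponent := by
  have := α.card_inter_le_minSeparatorCard
  have := card_le_card α.isolatedMiddle_subset
  rw [natLogExponent, logExponent, Nat.cast_add, Nat.cast_sub ‹_›, Nat.cast_sub ‹_›]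
  ring

theorem natPoly_add_natLog : α.natPolyExponent + α.natLogExponent =
    2 * Fintype.card V - α.left.card - α.right.card := by
  have := α.card_inter_le_minSeparatorCard
  have := card_le_card α.isolatedMiddle_subset
  have := α.minSeparatorCard_le_card
  have := α.card_middle_add
  rw [natPolyExponent, natLogExponent]
  omega

/-- The constant of the upper bound. -/
noncomputable def upperConst : ℝ :=
  √((1 + 2 * Fintype.card V) ^ (3 * Fintype.card V) *
    Real.exp (3 * Fintype.card V) * 2 ^ α.natLogExponent)

/-- Since d = p + f, the main factor is n^(qp) q^(qf). The boundary terms n^(2k) q^k are at most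
e^(3kq) because n and q are at most e^q, so the q-th power absorbs them into a constant. -/
theorem upper_arith {n q k p f d : ℕ} (hq : 1 ≤ q) (hn : 1 ≤ n) (hd : p + f = d) (hd2 : d ≤ 2 * k)
    (hlog : Real.log n ≤ q) (hlog2 : (q : ℝ) ≤ 2 * Real.log n) :
    ((n : ℝ) / q) ^ (q * p + 2 * k) * ((1 + 2 * k) * q) ^ (q * d + k) ≤
      ((1 + 2 * k) ^ (3 * k) * Real.exp (3 * k) * 2 ^ f * (n ^ p * Real.log n ^ f)) ^ q := by
  have hq1 : (1 : ℝ) ≤ q := by exact_mod_cast hq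
  have hn1 : (1 : ℝ) ≤ n := by exact_mod_cast hn
  have hq0 : (0 : ℝ) < q := by linarith
  have hl0 : 0 ≤ Real.log n := Real.log_nonneg hn1
  have hnexp : (n : ℝ) ≤ Real.exp q := by
    rw [← Real.log_le_iff_le_exp (by linarith)]
    exact hlog
  have hqexp : (q : ℝ) ≤ Real.exp q := by linarith [Real.add_one_le_exp (q : ℝ)]
  have hK : (1 : ℝ) ≤ 1 + 2 * k := by linarith [(Nat.cast_nonneg k : (0 : ℝ) ≤ k)]
  have e1 : ((n : ℝ) / q) ^ (q * p + 2 * k) * ((1 + 2 * k) * q) ^ (q * d + k) =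
      (1 + 2 * k) ^ (q * d + k) * (n ^ p) ^ q * (n ^ (2 * k) * (q : ℝ) ^ k) * (q ^ f) ^ q /
        q ^ (2 * k) := by
    rw [div_pow, mul_pow, ← hd]
    field_simp
    ring
  rw [e1]
  have e2 : (1 : ℝ) ≤ q ^ (2 * k) := one_le_pow₀ hq1
  refine (div_le_self (by positivity) e2).trans ?_
  have e3 : ((1 : ℝ) + 2 * k) ^ (q * d + k) ≤ (1 + 2 * k) ^ (3 * k * q) := by
    refine pow_le_pow_right₀ hK ?_
    nlinarith
  have e4 : (n : ℝ) ^ (2 * k) * (q : ℝ) ^ k ≤ Real.exp (3 * k) ^ q := by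
    calc (n : ℝ) ^ (2 * k) * (q : ℝ) ^ k ≤ Real.exp q ^ (2 * k) * Real.exp q ^ k := by gcongr
      _ = _ := by
        rw [← pow_add, ← Real.exp_nat_mul, ← Real.exp_nat_mul]
        congr 1
        push_cast
        ring
  have e5 : ((q : ℝ) ^ f) ^ q ≤ ((2 * Real.log n) ^ f) ^ q := by gcongr
  calc _ ≤ ((1 : ℝ) + 2 * k) ^ (3 * k * q) * (n ^ p) ^ q * Real.exp (3 * k) ^ q *
        ((2 * Real.log n) ^ f) ^ q := by gcongr
    _ = _ := by
        rw [pow_mul]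
        simp only [mul_pow]
        ring

/-- The upper bound for at least two labels. -/
theorem expect_norm_le_of_two_le {n : ℕ} (hn : 2 ≤ n) :
    𝔼 x, ‖α.graphMatrix n (signVal x)‖ ≤
      α.upperConst * ((n : ℝ) ^ (α.polyExponent / 2) * Real.log n ^ (α.logExponent / 2)) := by
  classical
  have hn2 : (2 : ℝ) ≤ n := by exact_mod_cast hn
  -- The threshold 1/2 rather than 1 is needed at n = 2, where log 2 < 1.
  have hlog_half : 1 / 2 < Real.log n :=
    lt_of_lt_of_le (by linarith [Real.log_two_gt_d9]) (Real.log_le_log (by norm_num) hn2)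
  obtain ⟨k, hk1, hk2⟩ := exists_two_pow_between hlog_half
  have hlogn : 2 * Real.log n ≤ n := by
    have h1 := Real.log_le_sub_one_of_pos (show (0 : ℝ) < n / 2 by linarith)
    rw [Real.log_div (by linarith) (by norm_num)] at h1
    linarith [Real.log_two_lt_d9]
  have hqn : 2 ^ k ≤ n := by
    have := hk2.trans hlogn
    exact_mod_cast this
  have hq1 : 1 ≤ 2 ^ k := Nat.one_le_two_pow
  have hl0 : 0 ≤ Real.log n := by linarith
  have h1 := (expect_pow_le _ (fun x => norm_nonneg (α.graphMatrix n (signVal x))) _).trans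
    ((α.expect_norm_pow_le k).trans (α.card_isRepeatedChain_le hq1 hqn))
  have h2 := h1.trans (upper_arith (p := α.natPolyExponent) (f := α.natLogExponent) hq1 (by omega)
    α.natPoly_add_natLog (by omega) (by exact_mod_cast hk1) (by exact_mod_cast hk2))
  -- Taking the root of order 2^k leaves a bound on the square of the mean norm.
  rw [pow_mul] at h2
  have h3 := le_of_pow_le_pow_left₀ (by positivity) (by positivity) h2
  have h4 := Real.le_sqrt_of_sq_le h3
  refine h4.trans (le_of_eq ?_)
  rw [upperConst, ← α.cast_natPolyExponent, ← α.cast_natLogExponent,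
    ← sqrt_pow_eq_rpow (Nat.cast_nonneg n), ← sqrt_pow_eq_rpow hl0,
    ← Real.sqrt_mul (x := (n : ℝ) ^ α.natPolyExponent) (by positivity),
    ← Real.sqrt_mul (by positivity)]

theorem one_le_upperConst : 1 ≤ α.upperConst := by
  rw [upperConst, Real.one_le_sqrt]
  have h1 : (1 : ℝ) ≤ (1 + 2 * Fintype.card V) ^ (3 * Fintype.card V) :=
    one_le_pow₀ (by linarith [(Nat.cast_nonneg (Fintype.card V) : (0 : ℝ) ≤ _)])
  have h2 : (1 : ℝ) ≤ Real.exp (3 * Fintype.card V) := Real.one_le_exp (by positivity)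
  have h3 : (1 : ℝ) ≤ 2 ^ α.natLogExponent := one_le_pow₀ (by norm_num)
  exact one_le_mul_of_one_le_of_one_le (one_le_mul_of_one_le_of_one_le h1 h2) h3

end Shape

/-! ### The left side of a separator, and algebra of monomials -/

namespace Shape

variable {V : Type*} [Fintype V] (α : Shape V) {n : ℕ}

section Reach

open Classical in
/-- The vertices that can be reached from the left vertices without meeting `S`. -/
noncomputable def leftReach (S : Finset V) : Finset V :=
  univ.filter fun a => ∃ u ∈ α.left, ∃ p : α.graph.Walk u a, ∀ x ∈ p.support, x ∉ S

theorem mem_leftReach {S : Finset V} {a : V} :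
    a ∈ α.leftReach S ↔ ∃ u ∈ α.left, ∃ p : α.graph.Walk u a, ∀ x ∈ p.support, x ∉ S := by
  simp [leftReach]

theorem mem_leftReach_of_left {S : Finset V} {u : V} (hu : u ∈ α.left) (hS : u ∉ S) :
    u ∈ α.leftReach S :=
  α.mem_leftReach.2 ⟨u, hu, .nil, by simpa using hS⟩

theorem notMem_leftReach_of_right {S : Finset V} (hsep : α.IsVertexSeparator S) {v : V}
    (hv : v ∈ α.right) : v ∉ α.leftReach S := by
  classical
  intro h
  obtain ⟨u, hu, p, hp⟩ := α.mem_leftReach.1 h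
  obtain ⟨x, hx, hxS⟩ := hsep u hu v hv p.bypass p.bypass_isPath
  exact hp x (p.support_bypass_subset_support hx) hxS

theorem mem_leftReach_of_adj {S : Finset V} {a b : V} (ha : a ∈ α.leftReach S)
    (hab : α.graph.Adj a b) (hb : b ∉ S) : b ∈ α.leftReach S := by
  obtain ⟨u, hu, p, hp⟩ := α.mem_leftReach.1 ha
  refine α.mem_leftReach.2 ⟨u, hu, p.concat hab, fun x hx => ?_⟩
  rw [SimpleGraph.Walk.support_concat, List.mem_append,
    List.mem_singleton] at hx
  rcases hx with hx | rfl
  exacts [hp x hx, hb]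

end Reach

section Monomials

theorem monomial_mul (φ : V ↪ Fin n) (x y : (⊤ : SimpleGraph (Fin n)).edgeSet → ℤˣ) :
    α.monomial φ (signVal (x * y)) = α.monomial φ (signVal x) * α.monomial φ (signVal y) := by
  simp only [monomial, signVal_mul, prod_mul_distrib]

theorem monomial_sq (φ : V ↪ Fin n) (x : (⊤ : SimpleGraph (Fin n)).edgeSet → ℤˣ) :
    α.monomial φ (signVal x) * α.monomial φ (signVal x) = 1 := by
  rw [monomial, ← prod_mul_distrib]
  exact prod_eq_one fun e _ => signVal_sq _ _

/-- The product is again a Rademacher monomial. Nonnegativity lets off-diagonal terms be dropped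
from second moments. -/
theorem expect_monomial_mul_nonneg (φ ψ : V ↪ Fin n) :
    0 ≤ 𝔼 x, α.monomial φ (signVal x) * α.monomial ψ (signVal x) := by
  classical
  have h := expect_prod_signVal_nonneg (univ : Finset (α.graph.edgeSet ⊕ α.graph.edgeSet))
    (Sum.elim (α.mapEdge φ) (α.mapEdge ψ))
  simp only [Fintype.prod_sum_type, Sum.elim_inl, Sum.elim_inr] at h
  exact h

theorem monomial_congr {φ ψ : V ↪ Fin n} (h : ∀ a b, α.graph.Adj a b → φ a = ψ a)
    (x : (⊤ : SimpleGraph (Fin n)).edgeSet → ℝ) : α.monomial φ x = α.monomial ψ x := by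
  refine prod_congr rfl fun e _ => ?_
  congr 1
  refine Subtype.ext (?_ : Sym2.map φ e = Sym2.map ψ e)
  obtain ⟨e, he⟩ := e
  induction e with
  | _ a b =>
    have hab : α.graph.Adj a b := he
    simp [h a b hab, h b a hab.symm]

theorem monomial_perm (σ : Equiv.Perm V) (hσ : ∀ a b, α.graph.Adj (σ a) (σ b) ↔ α.graph.Adj a b)
    (φ : V ↪ Fin n) (x : (⊤ : SimpleGraph (Fin n)).edgeSet → ℝ) :
    α.monomial (σ.toEmbedding.trans φ) x = α.monomial φ x := by
  classical
  let i : α.graph ≃g α.graph := ⟨σ, hσ _ _⟩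
  refine Fintype.prod_equiv i.mapEdgeSet _ _ fun e => ?_
  congr 1
  refine Subtype.ext (?_ : Sym2.map (σ.toEmbedding.trans φ) e = Sym2.map φ (Sym2.map σ e))
  rw [Sym2.map_map]
  rfl

end Monomials

/-! ### Extracting realizations by random signs on color classes -/

section Extraction

/-- The contribution of a realization to an entry of the graph matrix. -/
noncomputable def term (x : (⊤ : SimpleGraph (Fin n)).edgeSet → ℝ) (r : α.left → Fin n)
    (c : α.right → Fin n) (φ : V ↪ Fin n) : ℝ :=
  if α.rowOf φ = r ∧ α.colOf φ = c then α.monomial φ x else 0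

/-- The part of the graph matrix that comes from a set of realizations. -/
noncomputable def partialMatrix (s : Finset (V ↪ Fin n))
    (x : (⊤ : SimpleGraph (Fin n)).edgeSet → ℝ) : Matrix (α.left → Fin n) (α.right → Fin n) ℝ :=
  Matrix.of fun r c => ∑ φ ∈ s, α.term x r c φ

variable [DecidableEq V]

/-- The color classes of the edges of the shape, followed by the color classes of the edges of a
realization. -/
def colorPair (col : Fin n → Option V) (φ : V ↪ Fin n) :
    α.graph.edgeSet ⊕ α.graph.edgeSet → Sym2 (Option V) :=
  Sum.elim (fun e => Sym2.map some e.1) fun e => Sym2.map col (α.mapEdge φ e).1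

open Classical in
/-- The sign of a realization under a choice of signs of the color classes, normalized by the
sign of the shape. -/
noncomputable def colorSign (col : Fin n → Option V) (φ : V ↪ Fin n) (η : Sym2 (Option V) → ℤˣ) :
    ℝ :=
  ∏ i, signVal η (α.colorPair col φ i)

open Classical in
/-- The realizations that meet each color class of an edge of the shape exactly once. -/
noncomputable def goodRealizations (col : Fin n → Option V) : Finset (V ↪ Fin n) :=
  univ.filter fun φ => ∀ η, α.colorSign col φ η = 1

theorem expect_colorSign (col : Fin n → Option V) (φ : V ↪ Fin n) :
    𝔼 η, α.colorSign col φ η = if φ ∈ α.goodRealizations col then 1 else 0 := by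
  classical
  have h := expect_prod_signVal univ (α.colorPair col φ)
  by_cases hg : φ ∈ α.goodRealizations col
  · rw [if_pos hg]
    have hg := (mem_filter.1 hg).2
    simp only [hg, Fintype.expect_one]
  · rw [if_neg hg]
    exact h.resolve_left fun h' => hg (mem_filter.2 ⟨mem_univ _, h'.1⟩)

/-- The color class of `z` must occur a second time in the sign. Distinct edges of the shape have
distinct classes, so the repetition comes from the realization. -/
theorem exists_edge_of_mem_goodRealizations {col : Fin n → Option V} {φ : V ↪ Fin n}
    (h : φ ∈ α.goodRealizations col) {z : Sym2 V} (hz : z ∈ α.graph.edgeSet) :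
    ∃ e ∈ α.graph.edgeSet, Sym2.map col (Sym2.map φ e) = Sym2.map some z := by
  classical
  have hne : 𝔼 η, α.colorSign col φ η ≠ 0 := by
    rw [α.expect_colorSign col φ, if_pos h]
    exact one_ne_zero
  obtain ⟨j, -, hj, he⟩ := exists_ne_of_expect_prod_ne_zero univ _ hne (.inl ⟨z, hz⟩) (mem_univ _)
  rcases j with j | j
  · refine absurd ?_ hj
    have := Sym2.map.injective (Option.some_injective V) he
    exact congrArg Sum.inl (Subtype.ext this)
  · exact ⟨j, j.2, he⟩

/-- Multiplying every edge variable by the sign of its color class preserves the law and multiplies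
each monomial by a sign depending on its classes. Averaging against the sign of the shape
annihilates all realizations that are not good, and the norm is convex. -/
theorem expect_norm_partialMatrix_good_le (col : Fin n → Option V) :
    𝔼 x, ‖α.partialMatrix (α.goodRealizations col) (signVal x)‖ ≤
      𝔼 x, ‖α.graphMatrix n (signVal x)‖ := by
  classical
  let tw : (Sym2 (Option V) → ℤˣ) → (⊤ : SimpleGraph (Fin n)).edgeSet → ℤˣ :=
    fun η e => η (Sym2.map col e)
  let sg : (Sym2 (Option V) → ℤˣ) → ℝ := fun η =>
    ∏ e : α.graph.edgeSet, signVal η (Sym2.map some e)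
  have hsg : ∀ η, |sg η| = 1 := fun η => by
    rcases prod_signVal_eq_one_or univ η (fun e : α.graph.edgeSet => Sym2.map some (e : Sym2 V))
      with h | h <;> simp [sg, h]
  have hmon : ∀ φ : V ↪ Fin n, ∀ x η, sg η * α.monomial φ (signVal (x * tw η)) =
      α.monomial φ (signVal x) * α.colorSign col φ η := by
    intro φ x η
    rw [monomial_mul, colorSign, Fintype.prod_sum_type]
    change _ = _ * (sg η * ∏ e : α.graph.edgeSet, signVal η (Sym2.map col (α.mapEdge φ e)))
    have : α.monomial φ (signVal (tw η)) =
      ∏ e : α.graph.edgeSet, signVal η (Sym2.map col (α.mapEdge φ e)) := rfl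
    rw [this]
    ring
  have hN : (0 : ℝ) < Fintype.card (Sym2 (Option V) → ℤˣ) := by positivity
  have key : ∀ x, ∑ η, sg η • α.graphMatrix n (signVal (x * tw η)) =
      (Fintype.card (Sym2 (Option V) → ℤˣ) : ℝ) •
        α.partialMatrix (α.goodRealizations col) (signVal x) := by
    intro x
    ext r c
    simp only [Matrix.sum_apply, Matrix.smul_apply, smul_eq_mul, graphMatrix_apply, partialMatrix,
      Matrix.of_apply, mul_sum, term]
    rw [sum_comm, ← sum_filter_add_sum_filter_not univ (· ∈ α.goodRealizations col)]
    have h1 : ∀ φ : V ↪ Fin n, ∑ η, sg η * (if α.rowOf φ = r ∧ α.colOf φ = c then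
        α.monomial φ (signVal (x * tw η)) else 0) =
        Fintype.card (Sym2 (Option V) → ℤˣ) * ((if α.rowOf φ = r ∧ α.colOf φ = c then
        α.monomial φ (signVal x) else 0) * 𝔼 η, α.colorSign col φ η) := by
      intro φ
      rw [mul_left_comm, Fintype.card_mul_expect, mul_sum]
      refine sum_congr rfl fun η _ => ?_
      split_ifs
      · exact hmon φ x η
      · simp
    simp only [h1, expect_colorSign]
    rw [sum_eq_zero (s := univ.filter fun φ => ¬ φ ∈ α.goodRealizations col), add_zero]
    · refine sum_congr (by ext; simp) fun φ hφ => ?_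
      rw [if_pos hφ, mul_one]
    · intro φ hφ
      rw [if_neg (mem_filter.1 hφ).2]
      simp
  have h1 : ∀ x, ‖α.partialMatrix (α.goodRealizations col) (signVal x)‖ ≤
      𝔼 η, ‖α.graphMatrix n (signVal (x * tw η))‖ := by
    intro x
    rw [Fintype.expect_eq_sum_div_card, le_div_iff₀ hN, mul_comm]
    calc _ = ‖∑ η, sg η • α.graphMatrix n (signVal (x * tw η))‖ := by
          rw [key, norm_smul, Real.norm_of_nonneg hN.le]
      _ ≤ ∑ η, ‖sg η • α.graphMatrix n (signVal (x * tw η))‖ := norm_sum_le _ _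
      _ = _ := by simp [norm_smul, hsg]
  refine (expect_le_expect fun x _ => h1 x).trans (le_of_eq ?_)
  rw [expect_comm]
  simp only [expect_mul_right (fun x => ‖α.graphMatrix n (signVal x)‖)]
  simp

end Extraction

end Shape

/-! ### Good realizations as automorphic copies of colored ones -/

namespace Shape

variable {V : Type*} [Fintype V] [DecidableEq V] (α : Shape V) {n : ℕ}

theorem exists_adj_of_notMem_isolatedMiddle {a : V} (ha : a ∉ α.isolatedMiddle)
    (hl : a ∉ α.left) (hr : a ∉ α.right) : ∃ b, α.graph.Adj a b := by
  rw [mem_isolatedMiddle] at ha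
  by_contra! h
  exact ha ⟨by tauto, h⟩

theorem notMem_isolatedMiddle_of_adj {a b : V} (h : α.graph.Adj a b) : a ∉ α.isolatedMiddle :=
  fun ha => (α.mem_isolatedMiddle.1 ha).2 b h

open Classical in
/-- The realizations that respect the colors outside of the isolated middle vertices. -/
noncomputable def coloredRealizations (col : Fin n → Option V) : Finset (V ↪ Fin n) :=
  univ.filter fun φ => ∀ a ∉ α.isolatedMiddle, col (φ a) = some a

theorem mem_coloredRealizations {col : Fin n → Option V} {φ : V ↪ Fin n} :
    φ ∈ α.coloredRealizations col ↔ ∀ a ∉ α.isolatedMiddle, col (φ a) = some a := by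
  simp [coloredRealizations]

open Classical in
/-- The good realizations that respect the colors of the left and right vertices. -/
noncomputable def sideColoredRealizations (col : Fin n → Option V) : Finset (V ↪ Fin n) :=
  (α.goodRealizations col).filter fun φ =>
    (∀ u ∈ α.left, col (φ u) = some u) ∧ ∀ v ∈ α.right, col (φ v) = some v

open Classical in
/-- The automorphisms of the shape that fix the left, the right and the isolated middle
vertices. -/
noncomputable def fixingAut : Finset (Equiv.Perm V) :=
  univ.filter fun σ => (∀ a b, α.graph.Adj (σ a) (σ b) ↔ α.graph.Adj a b) ∧
    (∀ u ∈ α.left, σ u = u) ∧ (∀ v ∈ α.right, σ v = v) ∧ ∀ a ∈ α.isolatedMiddle, σ a = a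

theorem mem_fixingAut {σ : Equiv.Perm V} : σ ∈ α.fixingAut ↔
    (∀ a b, α.graph.Adj (σ a) (σ b) ↔ α.graph.Adj a b) ∧
    (∀ u ∈ α.left, σ u = u) ∧ (∀ v ∈ α.right, σ v = v) ∧ ∀ a ∈ α.isolatedMiddle, σ a = a := by
  simp [fixingAut]

theorem one_le_card_fixingAut : 1 ≤ α.fixingAut.card :=
  card_pos.2 ⟨1, α.mem_fixingAut.2 (by simp)⟩

theorem apply_notMem_isolatedMiddle {σ : Equiv.Perm V} (hσ : σ ∈ α.fixingAut) {a : V}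
    (ha : a ∉ α.isolatedMiddle) : σ a ∉ α.isolatedMiddle := fun h =>
  ha (σ.injective ((α.mem_fixingAut.1 hσ).2.2.2 _ h) ▸ h)

theorem trans_mem_sideColored {col : Fin n → Option V} {σ : Equiv.Perm V} (hσ : σ ∈ α.fixingAut)
    {φ : V ↪ Fin n} (hφ : φ ∈ α.coloredRealizations col) :
    σ.toEmbedding.trans φ ∈ α.sideColoredRealizations col := by
  classical
  obtain ⟨h1, h2, h3, h4⟩ := α.mem_fixingAut.1 hσ
  rw [mem_coloredRealizations] at hφ
  refine mem_filter.2 ⟨mem_filter.2 ⟨mem_univ _, fun η => ?_⟩, fun u hu => ?_, fun v hv => ?_⟩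
  · rw [colorSign, Fintype.prod_sum_type]
    have : ∏ e : α.graph.edgeSet,
        signVal η (α.colorPair col (σ.toEmbedding.trans φ) (.inr e)) =
        ∏ e : α.graph.edgeSet, signVal η (α.colorPair col φ (.inl e)) := by
      let i : α.graph ≃g α.graph := ⟨σ, h1 _ _⟩
      refine Fintype.prod_equiv i.mapEdgeSet _ _ fun e => ?_
      congr 1
      change Sym2.map col (Sym2.map (σ.toEmbedding.trans φ) e.1) = Sym2.map some (Sym2.map σ e.1)
      obtain ⟨e, he⟩ := e
      induction e with
      | _ a b =>
        have hab : α.graph.Adj a b := he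
        have ha := hφ _ (α.apply_notMem_isolatedMiddle hσ (α.notMem_isolatedMiddle_of_adj hab))
        have hb := hφ _ (α.apply_notMem_isolatedMiddle hσ (α.notMem_isolatedMiddle_of_adj hab.symm))
        simp [ha, hb]
    rw [this]
    change (∏ e : α.graph.edgeSet, signVal η (Sym2.map some e.1)) *
      (∏ e : α.graph.edgeSet, signVal η (Sym2.map some e.1)) = 1
    rw [← prod_mul_distrib]
    exact prod_eq_one fun e _ => signVal_sq _ _
  · have := hφ u fun h => (α.mem_isolatedMiddle.1 h).1 (Or.inl hu)
    simpa [h2 u hu] using this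
  · have := hφ v fun h => (α.mem_isolatedMiddle.1 h).1 (Or.inr hv)
    simpa [h3 v hv] using this

/-- The color of ψ a, with isolated middle vertices left fixed, defines a self-map of the shape. It
maps edges to edges and reaches every vertex, so it is an automorphism by finiteness; undoing it
yields a properly colored realization. -/
theorem exists_of_mem_sideColored {col : Fin n → Option V} {ψ : V ↪ Fin n}
    (hψ : ψ ∈ α.sideColoredRealizations col) :
    ∃ σ ∈ α.fixingAut, ∃ φ ∈ α.coloredRealizations col, σ.toEmbedding.trans φ = ψ := by
  classical
  obtain ⟨hgood, hleft, hright⟩ := mem_filter.1 hψ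
  let E : Finset (Sym2 V) := univ.filter (· ∈ α.graph.edgeSet)
  have hE : ∀ e, e ∈ E ↔ e ∈ α.graph.edgeSet := fun e => by simp [E]
  -- Every class of a shape edge is hit by the realization, which has no more edges than the shape.
  -- The two sets of classes therefore coincide.
  have himg : E.image (Sym2.map some) = E.image fun e => Sym2.map col (Sym2.map ψ e) := by
    refine eq_of_subset_of_card_le (fun z hz => ?_) ?_
    · obtain ⟨z, hzE, rfl⟩ := mem_image.1 hz
      obtain ⟨e, he, h⟩ := α.exists_edge_of_mem_goodRealizations hgood ((hE z).1 hzE)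
      exact mem_image.2 ⟨e, (hE e).2 he, h⟩
    · rw [card_image_of_injective _ (Sym2.map.injective (Option.some_injective V))]
      exact card_image_le
  have hadj : ∀ a b, α.graph.Adj a b → ∃ a' b', α.graph.Adj a' b' ∧
      col (ψ a) = some a' ∧ col (ψ b) = some b' := by
    intro a b hab
    have h1 : Sym2.map col (Sym2.map ψ s(a, b)) ∈ E.image (Sym2.map some) := by
      rw [himg]
      exact mem_image.2 ⟨_, (hE _).2 hab, rfl⟩
    obtain ⟨z, hz, h⟩ := mem_image.1 h1
    rw [hE] at hz
    induction z with
    | _ x y =>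
      have hxy : α.graph.Adj x y := hz
      simp only [Sym2.map_mk, Sym2.eq_iff] at h
      rcases h with ⟨h1, h2⟩ | ⟨h1, h2⟩
      exacts [⟨x, y, hxy, h1.symm, h2.symm⟩, ⟨y, x, hxy.symm, h2.symm, h1.symm⟩]
  have hadj' : ∀ x y, α.graph.Adj x y → ∃ a b, α.graph.Adj a b ∧
      col (ψ a) = some x ∧ col (ψ b) = some y := by
    intro x y hxy
    obtain ⟨e, he, h⟩ := α.exists_edge_of_mem_goodRealizations hgood
      (show s(x, y) ∈ α.graph.edgeSet from hxy)
    induction e with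
    | _ a b =>
      have hab : α.graph.Adj a b := he
      simp only [Sym2.map_mk, Sym2.eq_iff] at h
      rcases h with ⟨h1, h2⟩ | ⟨h1, h2⟩
      exacts [⟨a, b, hab, h1, h2⟩, ⟨b, a, hab.symm, h2, h1⟩]
  have hex : ∀ a, ∃ b, (a ∈ α.isolatedMiddle → b = a) ∧
      (a ∉ α.isolatedMiddle → col (ψ a) = some b) := by
    intro a
    by_cases ha : a ∈ α.isolatedMiddle
    · exact ⟨a, by simp [ha]⟩
    by_cases hl : a ∈ α.left
    · exact ⟨a, by simp [ha], fun _ => hleft a hl⟩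
    by_cases hr : a ∈ α.right
    · exact ⟨a, by simp [ha], fun _ => hright a hr⟩
    obtain ⟨b, hb⟩ := α.exists_adj_of_notMem_isolatedMiddle ha hl hr
    obtain ⟨a', -, -, h, -⟩ := hadj a b hb
    exact ⟨a', by simp [ha], fun _ => h⟩
  choose f hf1 hf2 using hex
  have hfl : ∀ u ∈ α.left, f u = u := fun u hu => by
    have h1 := hf2 u fun h => (α.mem_isolatedMiddle.1 h).1 (Or.inl hu)
    rw [hleft u hu] at h1
    exact (Option.some_injective _ h1).symm
  have hfr : ∀ v ∈ α.right, f v = v := fun v hv => by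
    have h1 := hf2 v fun h => (α.mem_isolatedMiddle.1 h).1 (Or.inr hv)
    rw [hright v hv] at h1
    exact (Option.some_injective _ h1).symm
  have hpre : ∀ x y, α.graph.Adj x y → ∃ a b, α.graph.Adj a b ∧ f a = x ∧ f b = y := by
    intro x y hxy
    obtain ⟨a, b, hab, ha, hb⟩ := hadj' x y hxy
    rw [hf2 a (α.notMem_isolatedMiddle_of_adj hab)] at ha
    rw [hf2 b (α.notMem_isolatedMiddle_of_adj hab.symm)] at hb
    exact ⟨a, b, hab, Option.some_injective _ ha, Option.some_injective _ hb⟩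
  have hsurj : Function.Surjective f := by
    intro z
    by_cases hz : z ∈ α.isolatedMiddle
    · exact ⟨z, hf1 z hz⟩
    by_cases hl : z ∈ α.left
    · exact ⟨z, hfl z hl⟩
    by_cases hr : z ∈ α.right
    · exact ⟨z, hfr z hr⟩
    obtain ⟨y, hy⟩ := α.exists_adj_of_notMem_isolatedMiddle hz hl hr
    obtain ⟨a, -, -, ha, -⟩ := hpre z y hy
    exact ⟨a, ha⟩
  have hbij : Function.Bijective f := ⟨Finite.injective_iff_surjective.2 hsurj, hsurj⟩
  let σ : Equiv.Perm V := Equiv.ofBijective f hbij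
  have hσ : σ ∈ α.fixingAut := by
    refine α.mem_fixingAut.2 ⟨fun a b => ⟨fun h => ?_, fun h => ?_⟩, hfl, hfr, hf1⟩
    · obtain ⟨a', b', h', ha, hb⟩ := hpre _ _ h
      rwa [hbij.1 ha, hbij.1 hb] at h'
    · obtain ⟨a', b', h', ha, hb⟩ := hadj a b h
      rw [hf2 a (α.notMem_isolatedMiddle_of_adj h)] at ha
      rw [hf2 b (α.notMem_isolatedMiddle_of_adj h.symm)] at hb
      rw [← Option.some_injective _ ha, ← Option.some_injective _ hb] at h'
      exact h'
  refine ⟨σ, hσ, σ.symm.toEmbedding.trans ψ, α.mem_coloredRealizations.2 fun a ha => ?_, ?_⟩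
  · have h1 : σ.symm a ∉ α.isolatedMiddle := fun h => by
      have := (α.mem_fixingAut.1 hσ).2.2.2 _ h
      rw [Equiv.apply_symm_apply] at this
      exact ha (this ▸ h)
    have h2 := hf2 _ h1
    have h3 : f (σ.symm a) = a := σ.apply_symm_apply a
    rw [h3] at h2
    exact h2
  · ext a
    simp

theorem term_trans {σ : Equiv.Perm V} (hσ : σ ∈ α.fixingAut) (φ : V ↪ Fin n)
    (x : (⊤ : SimpleGraph (Fin n)).edgeSet → ℝ) (r : α.left → Fin n) (c : α.right → Fin n) :
    α.term x r c (σ.toEmbedding.trans φ) = α.term x r c φ := by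
  obtain ⟨h1, h2, h3, h4⟩ := α.mem_fixingAut.1 hσ
  have hr : α.rowOf (σ.toEmbedding.trans φ) = α.rowOf φ := by
    ext u
    simp [rowOf, h2 u u.2]
  have hc : α.colOf (σ.toEmbedding.trans φ) = α.colOf φ := by
    ext v
    simp [colOf, h3 v v.2]
  rw [term, term, hr, hc, α.monomial_perm σ h1]

/-- Composition with automorphisms parametrizes the side-colored realizations bijectively and leaves
each term unchanged. The copies thus add up without cancellation. -/
theorem partialMatrix_sideColored (col : Fin n → Option V)
    (x : (⊤ : SimpleGraph (Fin n)).edgeSet → ℝ) :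
    α.partialMatrix (α.sideColoredRealizations col) x =
      (α.fixingAut.card : ℝ) • α.partialMatrix (α.coloredRealizations col) x := by
  classical
  ext r c
  simp only [partialMatrix, Matrix.of_apply, Matrix.smul_apply, smul_eq_mul]
  have h1 : ∑ z ∈ α.fixingAut ×ˢ α.coloredRealizations col, α.term x r c z.2 =
      ∑ φ ∈ α.sideColoredRealizations col, α.term x r c φ := by
    refine sum_bij (fun z _ => z.1.toEmbedding.trans z.2) ?_ ?_ ?_ ?_
    · intro z hz
      rw [mem_product] at hz
      exact α.trans_mem_sideColored hz.1 hz.2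
    · rintro ⟨σ, φ⟩ hz ⟨σ', φ'⟩ hz' h
      rw [mem_product] at hz hz'
      have hφ := α.mem_coloredRealizations.1 hz.2
      have hφ' := α.mem_coloredRealizations.1 hz'.2
      have happ : ∀ a, φ (σ a) = φ' (σ' a) := fun a => DFunLike.congr_fun h a
      obtain rfl : σ = σ' := by
        ext a
        by_cases ha : a ∈ α.isolatedMiddle
        · rw [(α.mem_fixingAut.1 hz.1).2.2.2 a ha, (α.mem_fixingAut.1 hz'.1).2.2.2 a ha]
        · have h1 := hφ _ (α.apply_notMem_isolatedMiddle hz.1 ha)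
          have h2 := hφ' _ (α.apply_notMem_isolatedMiddle hz'.1 ha)
          rw [happ, h2] at h1
          exact (Option.some_injective _ h1).symm
      refine Prod.ext rfl ?_
      ext1 a
      simpa using happ (σ.symm a)
    · intro ψ hψ
      obtain ⟨σ, hσ, φ, hφ, h⟩ := α.exists_of_mem_sideColored hψ
      exact ⟨(σ, φ), mem_product.2 ⟨hσ, hφ⟩, h⟩
    · rintro ⟨σ, φ⟩ hz
      exact (α.term_trans (mem_product.1 hz).1 φ x r c).symm
  rw [← h1, sum_product]
  simp

/-- The colors of left and right vertices can be read off the row and column indices, so imposing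
them only zeroes rows and columns. -/
theorem norm_partialMatrix_sideColored_le (col : Fin n → Option V)
    (x : (⊤ : SimpleGraph (Fin n)).edgeSet → ℝ) :
    ‖α.partialMatrix (α.sideColoredRealizations col) x‖ ≤
      ‖α.partialMatrix (α.goodRealizations col) x‖ := by
  classical
  refine le_of_eq_of_le (congrArg _ ?_) (l2_opNorm_restrict_le _
    (fun r => ∀ u : α.left, col (r u) = some (u : V))
    fun c => ∀ v : α.right, col (c v) = some (v : V))
  ext r c
  simp only [partialMatrix, Matrix.of_apply, sideColoredRealizations, sum_filter]
  split_ifs with h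
  · refine sum_congr rfl fun φ _ => ?_
    by_cases hφ : α.rowOf φ = r ∧ α.colOf φ = c
    · rw [if_pos]
      obtain ⟨rfl, rfl⟩ := hφ
      exact ⟨fun u hu => h.1 ⟨u, hu⟩, fun v hv => h.2 ⟨v, hv⟩⟩
    · simp [term, hφ]
  · refine sum_eq_zero fun φ _ => ?_
    split_ifs with h2
    · rw [term, if_neg]
      rintro ⟨rfl, rfl⟩
      exact h ⟨fun u => h2.1 u u.2, fun v => h2.2 v v.2⟩
    · rfl

/-- The colored part of the graph matrix is dominated by the graph matrix. -/
theorem expect_norm_colored_le (col : Fin n → Option V) :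
    𝔼 x, ‖α.partialMatrix (α.coloredRealizations col) (signVal x)‖ ≤
      𝔼 x, ‖α.graphMatrix n (signVal x)‖ := by
  refine le_trans (expect_le_expect fun x _ => ?_) (α.expect_norm_partialMatrix_good_le col)
  refine le_trans ?_ (α.norm_partialMatrix_sideColored_le col _)
  rw [partialMatrix_sideColored, norm_smul, Real.norm_of_nonneg (Nat.cast_nonneg _)]
  exact le_mul_of_one_le_left (norm_nonneg _) (by exact_mod_cast α.one_le_card_fixingAut)

end Shape

/-! ### Realizations on a grid with the separator pinned -/

namespace Shape

variable {V : Type*} [Fintype V] [DecidableEq V] (α : Shape V) {n m : ℕ}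

omit [Fintype V] [DecidableEq V] in
/-- The realization that puts the vertex `a` at the grid position `(a, h a)`. -/
def gridRealization (β : V × Fin (m + 1) ↪ Fin n) (h : V → Fin (m + 1)) : V ↪ Fin n :=
  ⟨fun a => β (a, h a), fun _ _ hab => congrArg Prod.fst (β.injective hab)⟩

omit [Fintype V] [DecidableEq V] in
theorem gridRealization_apply (β : V × Fin (m + 1) ↪ Fin n) (h : V → Fin (m + 1)) (a : V) :
    gridRealization β h a = β (a, h a) := rfl

open Classical in
/-- The color of a label: the vertex of its grid position, for admissible positions. -/
noncomputable def gridColor (S : Finset V) (β : V × Fin (m + 1) ↪ Fin n) (i : Fin n) : Option V :=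
  if h : ∃ z : V × Fin (m + 1), β z = i ∧ z.1 ∉ α.isolatedMiddle ∧ (z.1 ∈ S → z.2 = 0) then
    some h.choose.1 else none

theorem gridColor_eq_some_iff {S : Finset V} {β : V × Fin (m + 1) ↪ Fin n} {i : Fin n} {a : V} :
    α.gridColor S β i = some a ↔
      ∃ j, β (a, j) = i ∧ a ∉ α.isolatedMiddle ∧ (a ∈ S → j = 0) := by
  rw [gridColor]
  split_ifs with h
  · have hs := h.choose_spec
    constructor
    · intro ha
      have ha := Option.some_injective _ ha
      refine ⟨h.choose.2, ?_⟩
      rw [← ha]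
      exact hs
    · rintro ⟨j, hj, -⟩
      have := β.injective (hs.1.trans hj.symm)
      rw [this]
  · simp only [false_iff]
    rintro ⟨j, hj⟩
    exact h ⟨(a, j), hj⟩

/-- The grid positions that vanish on `S` and on the isolated middle vertices. -/
noncomputable def gridIndices (S : Finset V) (m : ℕ) : Finset (V → Fin (m + 1)) :=
  Fintype.piFinset fun a => if a ∈ S ∨ a ∈ α.isolatedMiddle then {0} else univ

theorem mem_gridIndices {S : Finset V} {h : V → Fin (m + 1)} :
    h ∈ α.gridIndices S m ↔ ∀ a, a ∈ S ∨ a ∈ α.isolatedMiddle → h a = 0 := by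
  rw [gridIndices, Fintype.mem_piFinset]
  refine forall_congr' fun a => ?_
  split_ifs with ha <;> simp [ha]

theorem le_card_gridIndices (S : Finset V) (m : ℕ) :
    (m + 1) ^ (Fintype.card V - S.card - α.isolatedMiddle.card) ≤ (α.gridIndices S m).card := by
  rw [gridIndices, Fintype.card_piFinset]
  have h1 : ∀ a, (if a ∈ S ∨ a ∈ α.isolatedMiddle then ({0} : Finset (Fin (m + 1)))
      else univ).card = if a ∈ univ \ (S ∪ α.isolatedMiddle) then m + 1 else 1 := by
    intro a
    by_cases h : a ∈ S ∨ a ∈ α.isolatedMiddle <;> simp [h]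
  simp only [h1, prod_ite_mem, univ_inter, prod_const]
  refine Nat.pow_le_pow_right (by omega) ?_
  rw [card_sdiff_of_subset (subset_univ _), card_univ]
  have := card_union_le S α.isolatedMiddle
  omega

open Classical in
/-- The realizations that agree with a grid realization off the isolated middle vertices. -/
noncomputable def gridExtensions (β : V × Fin (m + 1) ↪ Fin n) (h : V → Fin (m + 1)) :
    Finset (V ↪ Fin n) :=
  univ.filter fun φ => ∀ a ∉ α.isolatedMiddle, φ a = gridRealization β h a

theorem mem_gridExtensions {β : V × Fin (m + 1) ↪ Fin n} {h : V → Fin (m + 1)} {φ : V ↪ Fin n} :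
    φ ∈ α.gridExtensions β h ↔ ∀ a ∉ α.isolatedMiddle, φ a = gridRealization β h a := by
  simp [gridExtensions]

omit [Fintype V] [DecidableEq V] in
theorem exists_perm_comp_eq [Finite V] (φ ψ : V ↪ Fin n) :
    ∃ π : Equiv.Perm (Fin n), ∀ a, π (φ a) = ψ a := by
  classical
  let e := (Equiv.ofInjective φ φ.injective).symm.trans (Equiv.ofInjective ψ ψ.injective)
  refine ⟨e.extendSubtype, fun a => ?_⟩
  rw [e.extendSubtype_apply_of_mem _ ⟨a, rfl⟩]
  have : (⟨φ a, ⟨a, rfl⟩⟩ : Set.range φ) = Equiv.ofInjective φ φ.injective a := rfl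
  simp only [e, Equiv.trans_apply]
  rw [this, Equiv.symm_apply_apply]
  rfl

/-- A permutation of the labels carrying one grid realization to the other also carries its
extensions. -/
theorem card_gridExtensions_le (β : V × Fin (m + 1) ↪ Fin n) (h h' : V → Fin (m + 1)) :
    (α.gridExtensions β h).card ≤ (α.gridExtensions β h').card := by
  obtain ⟨π, hπ⟩ := exists_perm_comp_eq (gridRealization β h) (gridRealization β h')
  refine card_le_card_of_injOn (fun φ => φ.trans π.toEmbedding) (fun φ hφ => ?_) ?_
  · rw [mem_coe, mem_gridExtensions] at hφ ⊢
    intro a ha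
    rw [← hπ, ← hφ a ha]
    rfl
  · intro φ _ φ' _ heq
    ext1 a
    exact π.injective (DFunLike.congr_fun heq a)

theorem card_gridExtensions_eq (β : V × Fin (m + 1) ↪ Fin n) (h h' : V → Fin (m + 1)) :
    (α.gridExtensions β h).card = (α.gridExtensions β h').card :=
  (α.card_gridExtensions_le β h h').antisymm (α.card_gridExtensions_le β h' h)

/-- Each isolated middle vertex may take any label of its own column. -/
theorem le_card_gridExtensions (β : V × Fin (m + 1) ↪ Fin n) :
    (m + 1) ^ α.isolatedMiddle.card ≤ (α.gridExtensions β 0).card := by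
  let I : Finset (V → Fin (m + 1)) :=
    Fintype.piFinset fun a => if a ∈ α.isolatedMiddle then univ else {0}
  have hI : I.card = (m + 1) ^ α.isolatedMiddle.card := by
    rw [Fintype.card_piFinset]
    have h1 : ∀ a, (if a ∈ α.isolatedMiddle then univ else ({0} : Finset (Fin (m + 1)))).card =
        if a ∈ α.isolatedMiddle then m + 1 else 1 := fun a => by split_ifs <;> simp
    simp only [h1, prod_ite_mem, univ_inter, prod_const]
  rw [← hI]
  refine card_le_card_of_injOn (gridRealization β) (fun h hh => ?_) ?_
  · rw [mem_coe, mem_gridExtensions]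
    intro a ha
    have := Fintype.mem_piFinset.1 hh a
    rw [if_neg ha, mem_singleton] at this
    simp [gridRealization_apply, this]
  · intro h _ h' _ heq
    funext a
    exact congrArg Prod.snd (β.injective (DFunLike.congr_fun heq a))

theorem term_congr {φ ψ : V ↪ Fin n} (h : ∀ a ∉ α.isolatedMiddle, φ a = ψ a)
    (x : (⊤ : SimpleGraph (Fin n)).edgeSet → ℝ) (r : α.left → Fin n) (c : α.right → Fin n) :
    α.term x r c φ = α.term x r c ψ := by
  have hr : α.rowOf φ = α.rowOf ψ := funext fun u =>
    h u fun hu => (α.mem_isolatedMiddle.1 hu).1 (Or.inl u.2)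
  have hc : α.colOf φ = α.colOf ψ := funext fun v =>
    h v fun hv => (α.mem_isolatedMiddle.1 hv).1 (Or.inr v.2)
  rw [term, term, hr, hc,
    α.monomial_congr fun a b hab => h a (α.notMem_isolatedMiddle_of_adj hab)]

theorem coloredRealizations_eq_biUnion (S : Finset V) (β : V × Fin (m + 1) ↪ Fin n) :
    α.coloredRealizations (α.gridColor S β) =
      (α.gridIndices S m).biUnion (α.gridExtensions β) := by
  ext φ
  simp only [mem_coloredRealizations, mem_biUnion, mem_gridExtensions, mem_gridIndices,
    gridColor_eq_some_iff]
  constructor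
  · intro h
    have h1 : ∀ a, ∃ j, (a ∉ α.isolatedMiddle → β (a, j) = φ a ∧ (a ∈ S → j = 0)) ∧
        (a ∈ α.isolatedMiddle → j = 0) := by
      intro a
      by_cases ha : a ∈ α.isolatedMiddle
      · exact ⟨0, by simp [ha]⟩
      · obtain ⟨j, h1, -, h2⟩ := h a ha
        exact ⟨j, fun _ => ⟨h1, h2⟩, fun h => absurd h ha⟩
    choose j h1 h2 using h1
    refine ⟨j, fun a ha => ?_, fun a ha => (h1 a ha).1.symm⟩
    by_cases hi : a ∈ α.isolatedMiddle
    · exact h2 a hi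
    · exact (h1 a hi).2 (ha.resolve_right hi)
  · rintro ⟨j, h1, h2⟩ a ha
    exact ⟨j a, (h2 a ha).symm, ha, fun hS => h1 a (Or.inl hS)⟩

/-- The part of the graph matrix that comes from grid realizations. -/
noncomputable def gridMatrix (S : Finset V) (β : V × Fin (m + 1) ↪ Fin n)
    (x : (⊤ : SimpleGraph (Fin n)).edgeSet → ℝ) : Matrix (α.left → Fin n) (α.right → Fin n) ℝ :=
  Matrix.of fun r c => ∑ h ∈ α.gridIndices S m, α.term x r c (gridRealization β h)

/-- Terms do not see the labels of isolated middle vertices, and every grid realization has the same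
number of extensions, which becomes a scalar factor. -/
theorem partialMatrix_colored (S : Finset V) (β : V × Fin (m + 1) ↪ Fin n)
    (x : (⊤ : SimpleGraph (Fin n)).edgeSet → ℝ) :
    α.partialMatrix (α.coloredRealizations (α.gridColor S β)) x =
      ((α.gridExtensions β 0).card : ℝ) • α.gridMatrix S β x := by
  ext r c
  simp only [partialMatrix, Matrix.of_apply, Matrix.smul_apply, smul_eq_mul, gridMatrix]
  rw [coloredRealizations_eq_biUnion, sum_biUnion, mul_sum]
  · refine sum_congr rfl fun h _ => ?_
    rw [sum_congr rfl fun φ hφ => α.term_congr (α.mem_gridExtensions.1 hφ) x r c, sum_const,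
      nsmul_eq_mul, α.card_gridExtensions_eq β h 0]
  · intro h hh h' hh' hne
    rw [Function.onFun, disjoint_left]
    intro φ hφ hφ'
    rw [mem_gridExtensions] at hφ hφ'
    refine hne (funext fun a => ?_)
    by_cases ha : a ∈ α.isolatedMiddle
    · rw [α.mem_gridIndices.1 hh a (Or.inr ha), α.mem_gridIndices.1 hh' a (Or.inr ha)]
    · exact congrArg Prod.snd (β.injective ((hφ a ha).symm.trans (hφ' a ha)))

theorem expect_norm_gridMatrix_le (S : Finset V) (β : V × Fin (m + 1) ↪ Fin n) :
    ((m + 1 : ℕ) : ℝ) ^ α.isolatedMiddle.card * 𝔼 x, ‖α.gridMatrix S β (signVal x)‖ ≤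
      𝔼 x, ‖α.graphMatrix n (signVal x)‖ := by
  refine le_trans ?_ (α.expect_norm_colored_le (α.gridColor S β))
  have h1 : ∀ x, ‖α.partialMatrix (α.coloredRealizations (α.gridColor S β)) (signVal x)‖ =
      (α.gridExtensions β 0).card * ‖α.gridMatrix S β (signVal x)‖ := fun x => by
    rw [partialMatrix_colored, norm_smul, Real.norm_of_nonneg (Nat.cast_nonneg _)]
  simp only [h1]
  rw [← mul_expect]
  have h2 : 0 ≤ 𝔼 x, ‖α.gridMatrix S β (signVal x)‖ := expect_nonneg fun _ _ => norm_nonneg _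
  gcongr
  exact_mod_cast α.le_card_gridExtensions β

/-! ### Recombination across the separator -/

section RankOne

/-- Follow the first position on `A` and the second one elsewhere. -/
def mixGrid (A : Finset V) (h h' : V → Fin (m + 1)) : V → Fin (m + 1) :=
  fun a => if a ∈ A then h a else h' a

theorem mixGrid_mem {S : Finset V} (A : Finset V) {h h' : V → Fin (m + 1)}
    (hh : h ∈ α.gridIndices S m) (hh' : h' ∈ α.gridIndices S m) :
    mixGrid A h h' ∈ α.gridIndices S m := by
  rw [mem_gridIndices] at *
  intro a ha
  rw [mixGrid]
  split_ifs
  exacts [hh a ha, hh' a ha]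

omit [Fintype V] in
theorem mixGrid_mixGrid (A : Finset V) (h h' : V → Fin (m + 1)) :
    mixGrid A (mixGrid A h h') (mixGrid A h' h) = h := by
  funext a
  by_cases ha : a ∈ A <;> simp [mixGrid, ha]

variable {S : Finset V}

theorem mixGrid_eq_left {h h' : V → Fin (m + 1)} (hh : h ∈ α.gridIndices S m)
    (hh' : h' ∈ α.gridIndices S m) {a : V} (ha : a ∈ α.leftReach S ∨ a ∈ S) :
    mixGrid (α.leftReach S) h h' a = h a := by
  rw [mixGrid]
  split_ifs with hA
  · rfl
  · have := ha.resolve_left hA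
    rw [α.mem_gridIndices.1 hh a (Or.inl this), α.mem_gridIndices.1 hh' a (Or.inl this)]

theorem mixGrid_eq_right {h h' : V → Fin (m + 1)} {a : V} (ha : a ∉ α.leftReach S) :
    mixGrid (α.leftReach S) h h' a = h' a := if_neg ha

/-- An edge meeting the left side lies in the left side or in `S`, where both positions are 0. Every
edge thus takes its labels wholly from `h` or wholly from `h'`, and mixing merely swaps the two
factors. -/
theorem monomial_mixGrid {h h' : V → Fin (m + 1)} (hh : h ∈ α.gridIndices S m)
    (hh' : h' ∈ α.gridIndices S m) (β : V × Fin (m + 1) ↪ Fin n)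
    (x : (⊤ : SimpleGraph (Fin n)).edgeSet → ℝ) :
    α.monomial (gridRealization β (mixGrid (α.leftReach S) h h')) x *
      α.monomial (gridRealization β (mixGrid (α.leftReach S) h' h)) x =
      α.monomial (gridRealization β h) x * α.monomial (gridRealization β h') x := by
  classical
  have hcongr : ∀ (g g' : V → Fin (m + 1)) (e : α.graph.edgeSet), (∀ a ∈ e.1, g a = g' a) →
      α.mapEdge (gridRealization β g) e = α.mapEdge (gridRealization β g') e := by
    intro g g' e h
    refine Subtype.ext (?_ : Sym2.map (gridRealization β g) e.1 = Sym2.map (gridRealization β g') e.1)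
    exact Sym2.map_congr fun a ha => by simp [gridRealization_apply, h a ha]
  simp only [monomial, ← prod_mul_distrib]
  refine prod_congr rfl fun e _ => ?_
  by_cases he : ∀ a ∈ e.1, a ∉ α.leftReach S
  · rw [hcongr _ h' e fun a ha => α.mixGrid_eq_right (he a ha),
      hcongr _ h e fun a ha => α.mixGrid_eq_right (he a ha), mul_comm]
  · push Not at he
    obtain ⟨a, ha, haA⟩ := he
    have hall : ∀ b ∈ e.1, b ∈ α.leftReach S ∨ b ∈ S := by
      intro b hb
      by_cases hab : a = b
      · exact Or.inl (hab ▸ haA)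
      · have hadj : α.graph.Adj a b := by
          have := (Sym2.mem_and_mem_iff hab).1 ⟨ha, hb⟩
          have he := e.2
          rwa [this] at he
        by_cases hS : b ∈ S
        · exact Or.inr hS
        · exact Or.inl (α.mem_leftReach_of_adj haA hadj hS)
    rw [hcongr _ h e fun b hb => α.mixGrid_eq_left hh hh' (hall b hb),
      hcongr _ h' e fun b hb => α.mixGrid_eq_left hh' hh (hall b hb)]

theorem rowOf_mixGrid {h h' : V → Fin (m + 1)} (hh : h ∈ α.gridIndices S m)
    (hh' : h' ∈ α.gridIndices S m) (β : V × Fin (m + 1) ↪ Fin n) :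
    α.rowOf (gridRealization β (mixGrid (α.leftReach S) h h')) = α.rowOf (gridRealization β h) := by
  funext u
  have hu : (u : V) ∈ α.leftReach S ∨ (u : V) ∈ S := by
    by_cases hS : (u : V) ∈ S
    exacts [Or.inr hS, Or.inl (α.mem_leftReach_of_left u.2 hS)]
  simp [rowOf, gridRealization_apply, α.mixGrid_eq_left hh hh' hu]

theorem colOf_mixGrid (hsep : α.IsVertexSeparator S) (h h' : V → Fin (m + 1))
    (β : V × Fin (m + 1) ↪ Fin n) :
    α.colOf (gridRealization β (mixGrid (α.leftReach S) h h')) =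
      α.colOf (gridRealization β h') := by
  funext v
  simp [colOf, gridRealization_apply, α.mixGrid_eq_right (α.notMem_leftReach_of_right hsep v.2)]

/-- The two-by-two minors of the grid part of the graph matrix vanish. -/
theorem gridMatrix_minor (hsep : α.IsVertexSeparator S) (β : V × Fin (m + 1) ↪ Fin n)
    (x : (⊤ : SimpleGraph (Fin n)).edgeSet → ℝ) (r r' : α.left → Fin n)
    (c c' : α.right → Fin n) :
    α.gridMatrix S β x r c * α.gridMatrix S β x r' c' =
      α.gridMatrix S β x r c' * α.gridMatrix S β x r' c := by
  simp only [gridMatrix, Matrix.of_apply, sum_mul_sum, ← sum_product']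
  -- Exchanging the two sides of the separator is an involution on pairs. The first new realization
  -- has the row of `h` and the column of `h'`, the second the reverse.
  refine sum_nbij' (fun z => (mixGrid (α.leftReach S) z.1 z.2, mixGrid (α.leftReach S) z.2 z.1))
    (fun z => (mixGrid (α.leftReach S) z.1 z.2, mixGrid (α.leftReach S) z.2 z.1)) ?_ ?_ ?_ ?_ ?_
  · rintro ⟨h, h'⟩ hz
    rw [mem_product] at hz
    exact mem_product.2 ⟨α.mixGrid_mem _ hz.1 hz.2, α.mixGrid_mem _ hz.2 hz.1⟩
  · rintro ⟨h, h'⟩ hz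
    rw [mem_product] at hz
    exact mem_product.2 ⟨α.mixGrid_mem _ hz.1 hz.2, α.mixGrid_mem _ hz.2 hz.1⟩
  · rintro ⟨h, h'⟩ _
    simp only [mixGrid_mixGrid]
  · rintro ⟨h, h'⟩ _
    simp only [mixGrid_mixGrid]
  · rintro ⟨h, h'⟩ hz
    obtain ⟨hh, hh'⟩ := mem_product.1 hz
    simp only at hh hh'
    simp only [term, α.rowOf_mixGrid hh hh', α.rowOf_mixGrid hh' hh, α.colOf_mixGrid hsep]
    have := α.monomial_mixGrid hh hh' β x
    split_ifs <;> first | tauto | simp_all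

end RankOne

end Shape

/-! ### The lower bound -/

namespace Shape

variable {V : Type*} [Fintype V] [DecidableEq V] (α : Shape V) {n m : ℕ}

omit [DecidableEq V] in
open Classical in
theorem monomial_eq_prod_image (φ : V ↪ Fin n) (x : (⊤ : SimpleGraph (Fin n)).edgeSet → ℝ) :
    α.monomial φ x = ∏ e ∈ univ.image (α.mapEdge φ), x e := by
  rw [prod_image fun _ _ _ _ h => α.mapEdge_injective φ h]
  rfl

/-- The number of edges of a shape. -/
noncomputable def edgeCount : ℕ := Nat.card α.graph.edgeSet

theorem expect_gridMatrix_pow_four_le (S : Finset V) (β : V × Fin (m + 1) ↪ Fin n)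
    (r : α.left → Fin n) (c : α.right → Fin n) :
    𝔼 x, α.gridMatrix S β (signVal x) r c ^ 4 ≤
      9 ^ α.edgeCount * (𝔼 x, α.gridMatrix S β (signVal x) r c ^ 2) ^ 2 := by
  classical
  have h1 : ∀ x, α.gridMatrix S β (signVal x) r c = ∑ h ∈ α.gridIndices S m,
      (if α.rowOf (gridRealization β h) = r ∧ α.colOf (gridRealization β h) = c then (1 : ℝ)
        else 0) * ∏ e ∈ univ.image (α.mapEdge (gridRealization β h)), signVal x e := by
    intro x
    simp only [gridMatrix, Matrix.of_apply, term, monomial_eq_prod_image, ite_mul, one_mul,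
      zero_mul]
  simp only [h1]
  refine bonami_fourth_moment univ _ _ _ (fun _ _ => subset_univ _) (fun h _ => ?_) _
  refine card_image_le.trans ?_
  rw [card_univ, edgeCount, Nat.card_eq_fintype_card]

/-- Off-diagonal pairs contribute nonnegatively to the mean square, and each diagonal pair
contributes 1 in exactly one entry. -/
theorem card_gridIndices_le_expect (S : Finset V) (β : V × Fin (m + 1) ↪ Fin n) :
    ((α.gridIndices S m).card : ℝ) ≤
      𝔼 x, ∑ z : (α.left → Fin n) × (α.right → Fin n),
        α.gridMatrix S β (signVal x) z.1 z.2 ^ 2 := by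
  classical
  rw [expect_sum_comm]
  have hterm : ∀ (z : (α.left → Fin n) × (α.right → Fin n)) (h h' : V → Fin (m + 1)),
      0 ≤ 𝔼 x, α.term (signVal x) z.1 z.2 (gridRealization β h) *
        α.term (signVal x) z.1 z.2 (gridRealization β h') := by
    intro z h h'
    simp only [term, ite_mul, mul_ite, zero_mul, mul_zero]
    split_ifs
    · exact α.expect_monomial_mul_nonneg _ _
    all_goals simp
  have hdiag : ∀ (z : (α.left → Fin n) × (α.right → Fin n)) (h : V → Fin (m + 1)),
      𝔼 x, α.term (signVal x) z.1 z.2 (gridRealization β h) *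
        α.term (signVal x) z.1 z.2 (gridRealization β h) =
      if z = (α.rowOf (gridRealization β h), α.colOf (gridRealization β h)) then 1 else 0 := by
    rintro ⟨r, c⟩ h
    simp only [term, Prod.mk.injEq, eq_comm (a := r), eq_comm (a := c)]
    split_ifs <;> simp [monomial_sq]
  have hz : ∀ z : (α.left → Fin n) × (α.right → Fin n),
      ∑ h ∈ α.gridIndices S m,
        (if z = (α.rowOf (gridRealization β h), α.colOf (gridRealization β h)) then (1 : ℝ)
          else 0) ≤ 𝔼 x, α.gridMatrix S β (signVal x) z.1 z.2 ^ 2 := by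
    intro z
    simp only [gridMatrix, Matrix.of_apply, sq, sum_mul_sum, expect_sum_comm]
    refine sum_le_sum fun h hh => ?_
    rw [← hdiag]
    exact single_le_sum (f := fun h' => 𝔼 x, α.term (signVal x) z.1 z.2 (gridRealization β h) *
      α.term (signVal x) z.1 z.2 (gridRealization β h')) (fun h' _ => hterm z h h') hh
  refine le_trans (le_of_eq ?_) (sum_le_sum fun z _ => hz z)
  rw [sum_comm]
  simp

/-- Vanishing minors replace the operator norm by the Frobenius norm, whose mean is comparable to
the root of its second moment by hypercontractivity. -/
theorem sqrt_card_gridIndices_le {S : Finset V} (hsep : α.IsVertexSeparator S)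
    (β : V × Fin (m + 1) ↪ Fin n) :
    √((α.gridIndices S m).card : ℝ) / (2 * √(2 * 9 ^ α.edgeCount)) ≤
      𝔼 x, ‖α.gridMatrix S β (signVal x)‖ := by
  have h1 := expect_sum_sq_sq_le univ
    (fun (z : (α.left → Fin n) × (α.right → Fin n)) x => α.gridMatrix S β (signVal x) z.1 z.2)
    (by positivity) fun z _ => α.expect_gridMatrix_pow_four_le S β z.1 z.2
  have h2 := sqrt_expect_le (fun x => by positivity) (by positivity) h1
  refine le_trans ?_ (h2.trans (expect_le_expect fun x _ => ?_))
  · gcongr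
    exact α.card_gridIndices_le_expect S β
  · rw [Fintype.sum_prod_type]
    exact Real.sqrt_le_iff.2
      ⟨norm_nonneg _, sum_sq_le_l2_opNorm_sq _ fun r c r' c' =>
        α.gridMatrix_minor hsep β _ r r' c c'⟩

/-- The constant of the lower bound. -/
noncomputable def lowerConst : ℝ :=
  1 / (√((2 * Fintype.card V : ℝ) ^ α.natPolyExponent) * (2 * √(2 * 9 ^ α.edgeCount)))

theorem natPolyExponent_eq_zero_of_card (h : Fintype.card V = 0) : α.natPolyExponent = 0 := by
  have h1 : α.isolatedMiddle.card ≤ Fintype.card V := card_le_univ _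
  rw [natPolyExponent]
  omega

theorem scale_pos : 0 < √((2 * Fintype.card V : ℝ) ^ α.natPolyExponent) := by
  refine Real.sqrt_pos.2 ?_
  rcases Nat.eq_zero_or_pos (Fintype.card V) with h | h
  · rw [α.natPolyExponent_eq_zero_of_card h, pow_zero]
    exact one_pos
  · positivity

theorem lowerConst_pos : 0 < α.lowerConst := by
  have := α.scale_pos
  rw [lowerConst]
  positivity

theorem exists_grid_size (hn : Fintype.card V ≤ n) :
    ∃ m : ℕ, Fintype.card V * (m + 1) ≤ n ∧
      (n : ℝ) ^ α.natPolyExponent ≤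
        (2 * Fintype.card V : ℝ) ^ α.natPolyExponent * ((m + 1 : ℕ) : ℝ) ^ α.natPolyExponent := by
  rcases Nat.eq_zero_or_pos (Fintype.card V) with h | h
  · exact ⟨0, by omega, by rw [α.natPolyExponent_eq_zero_of_card h]; simp⟩
  · have h1 : 1 ≤ n / Fintype.card V := Nat.div_pos hn h
    refine ⟨n / Fintype.card V - 1, ?_, ?_⟩
    · rw [Nat.sub_add_cancel h1]
      exact Nat.mul_div_le _ _
    · rw [Nat.sub_add_cancel h1, ← mul_pow]
      have h2 : n ≤ 2 * Fintype.card V * (n / Fintype.card V) := by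
        have := Nat.lt_mul_div_succ n h
        nlinarith
      gcongr
      exact_mod_cast h2

theorem lowerConst_mul_le (hn : Fintype.card V ≤ n) :
    α.lowerConst * (n : ℝ) ^ (α.polyExponent / 2) ≤ 𝔼 x, ‖α.graphMatrix n (signVal x)‖ := by
  obtain ⟨m, hm, hnm⟩ := α.exists_grid_size hn
  obtain ⟨S, hsep, hS⟩ := α.exists_separator_card_eq
  obtain ⟨β⟩ : Nonempty (V × Fin (m + 1) ↪ Fin n) :=
    Function.Embedding.nonempty_of_card_le (by simpa using hm)
  set M : ℝ := ((m + 1 : ℕ) : ℝ) with hM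
  have hM1 : 1 ≤ M := by rw [hM]; exact_mod_cast Nat.le_add_left 1 m
  have h1 := α.expect_norm_gridMatrix_le S β
  have h2 := α.sqrt_card_gridIndices_le hsep β
  have h3 : √(M ^ α.natPolyExponent) ≤
      M ^ α.isolatedMiddle.card * √((α.gridIndices S m).card : ℝ) := by
    refine Real.sqrt_le_iff.2 ⟨by positivity, ?_⟩
    rw [mul_pow, Real.sq_sqrt (Nat.cast_nonneg _), ← pow_mul]
    have h4 : M ^ (Fintype.card V - S.card - α.isolatedMiddle.card) ≤
        ((α.gridIndices S m).card : ℝ) := by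
      rw [hM]
      exact_mod_cast α.le_card_gridIndices S m
    -- The multiplicity of the isolated middle vertices enters squared, the grid positions once:
    -- 2|W_iso| + (|V| - |S| - |W_iso|) is at least |V| + |W_iso| - |S|.
    calc M ^ α.natPolyExponent ≤ M ^ (α.isolatedMiddle.card * 2 +
          (Fintype.card V - S.card - α.isolatedMiddle.card)) := by
          refine pow_le_pow_right₀ hM1 ?_
          rw [natPolyExponent, hS]
          omega
      _ ≤ _ := by
          rw [pow_add]
          gcongr
  have hK : (0 : ℝ) < 2 * √(2 * 9 ^ α.edgeCount) := by positivity
  have hs := α.scale_pos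
  calc α.lowerConst * (n : ℝ) ^ (α.polyExponent / 2)
      = √((n : ℝ) ^ α.natPolyExponent) / (√((2 * Fintype.card V : ℝ) ^ α.natPolyExponent) *
          (2 * √(2 * 9 ^ α.edgeCount))) := by
        rw [sqrt_pow_eq_rpow (Nat.cast_nonneg n), cast_natPolyExponent, lowerConst]
        ring
    _ ≤ √((2 * Fintype.card V : ℝ) ^ α.natPolyExponent * M ^ α.natPolyExponent) /
          (√((2 * Fintype.card V : ℝ) ^ α.natPolyExponent) * (2 * √(2 * 9 ^ α.edgeCount))) := by
        gcongr
    _ = √(M ^ α.natPolyExponent) / (2 * √(2 * 9 ^ α.edgeCount)) := by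
        rw [Real.sqrt_mul (by positivity), mul_div_mul_left _ _ hs.ne']
    _ ≤ M ^ α.isolatedMiddle.card * √((α.gridIndices S m).card : ℝ) /
          (2 * √(2 * 9 ^ α.edgeCount)) := by gcongr
    _ = M ^ α.isolatedMiddle.card *
          (√((α.gridIndices S m).card : ℝ) / (2 * √(2 * 9 ^ α.edgeCount))) := by ring
    _ ≤ M ^ α.isolatedMiddle.card * 𝔼 x, ‖α.gridMatrix S β (signVal x)‖ := by gcongr
    _ ≤ _ := h1

/-! ### The upper bound for n ≤ 1, where the logarithm vanishes -/

section FewLabels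

theorem natLogExponent_eq_zero [Subsingleton V] : α.natLogExponent = 0 := by
  have h1 : α.minSeparatorCard ≤ (α.left ∩ α.right).card := by
    refine α.minSeparatorCard_le fun u hu v hv p _ => ⟨u, p.start_mem_support, ?_⟩
    rw [mem_inter]
    exact ⟨hu, Subsingleton.elim v u ▸ hv⟩
  have h2 : α.middle.card ≤ α.isolatedMiddle.card := by
    refine card_le_card fun a ha => α.mem_isolatedMiddle.2 ⟨?_, fun b hab => ?_⟩
    · simpa [middle] using ha
    · exact hab.ne (Subsingleton.elim a b)
  rw [natLogExponent]
  omega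

theorem norm_graphMatrix_le_one (hn : n ≤ 1) (x : (⊤ : SimpleGraph (Fin n)).edgeSet → ℤˣ) :
    ‖α.graphMatrix n (signVal x)‖ ≤ 1 := by
  classical
  have : Subsingleton (Fin n) := Fin.subsingleton_iff_le_one.2 hn
  have hsum : ∀ {X : Type _} [Fintype X] [Subsingleton X] (f : X → ℝ), (∀ z, f z ≤ 1) →
      ∑ z, f z ≤ 1 := by
    intro X _ _ f hf
    refine (sum_le_card_nsmul univ f 1 fun z _ => hf z).trans ?_
    have : Fintype.card X ≤ 1 := Fintype.card_le_one_iff_subsingleton.2 ‹_›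
    simpa using this
  have hentry : ∀ r c, α.graphMatrix n (signVal x) r c ^ 2 ≤ 1 := by
    intro r c
    rw [sq_le_one_iff_abs_le_one, graphMatrix_apply]
    have : Subsingleton (V ↪ Fin n) := DFunLike.coe_injective.subsingleton
    refine (abs_sum_le_sum_abs _ _).trans ?_
    refine (sum_le_card_nsmul univ _ 1 fun φ _ => ?_).trans
      (by simpa using Fintype.card_le_one_iff_subsingleton.2 this)
    split_ifs
    · rw [monomial]
      rcases prod_signVal_eq_one_or univ x (α.mapEdge φ) with h | h <;> simp [h]
    · simp
  have h := (l2_opNorm_sq_le_sum_sq (α.graphMatrix n (signVal x))).trans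
    (hsum _ fun r => hsum _ fun c => hentry r c)
  exact (sq_le_one_iff₀ (norm_nonneg _)).1 h

theorem expect_norm_le_of_le_one (hn : n ≤ 1) :
    𝔼 x, ‖α.graphMatrix n (signVal x)‖ ≤
      α.upperConst * ((n : ℝ) ^ (α.polyExponent / 2) * Real.log n ^ (α.logExponent / 2)) := by
  -- For n = 0 this is the default value of the logarithm.
  have hlog : Real.log n = 0 := by
    interval_cases n <;> simp
  -- Either the shape has at most one vertex, so the exponent of the logarithm is 0 and 0^0 = 1
  -- applies, or there is no realization and the matrix is 0.
  by_cases hV : Fintype.card V ≤ n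
  · have : Subsingleton V := Fintype.card_le_one_iff_subsingleton.1 (hV.trans hn)
    rw [← cast_natLogExponent, natLogExponent_eq_zero, hlog]
    have h1 : (n : ℝ) ^ (α.polyExponent / 2) = 1 := by
      rcases Nat.le_one_iff_eq_zero_or_eq_one.1 hn with rfl | rfl
      · rw [← cast_natPolyExponent, α.natPolyExponent_eq_zero_of_card (by omega)]
        simp
      · simp
    rw [h1]
    simp only [CharP.cast_eq_zero, zero_div, Real.rpow_zero, mul_one]
    exact (expect_le univ_nonempty fun x _ => α.norm_graphMatrix_le_one hn x).trans
      α.one_le_upperConst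
  · have : IsEmpty (V ↪ Fin n) := by
      refine ⟨fun φ => hV ?_⟩
      simpa using Fintype.card_le_of_embedding φ
    have h0 : ∀ x, α.graphMatrix n x = 0 := fun x => by
      ext r c
      rw [graphMatrix_apply]
      simp
    simp only [h0, norm_zero, expect_const_zero]
    have := α.one_le_upperConst
    rw [hlog]
    positivity

end FewLabels

end Shape

theorem mainTheorem6 {V : Type*} [Fintype V] [DecidableEq V] (α : Shape V) :
    ∃ c C : ℝ, 0 < c ∧ 0 < C ∧
      ∀ (n : ℕ) {Ω : Type*} [MeasurableSpace Ω] (P : MeasureTheory.Measure Ω)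
        [MeasureTheory.IsProbabilityMeasure P]
        (ε : (⊤ : SimpleGraph (Fin n)).edgeSet → Ω → ℝ), IsRademacherFamily ε P →
        (Fintype.card V ≤ n →
          c * (n : ℝ) ^ (α.polyExponent / 2) ≤ ∫ ω, ‖α.graphMatrix n (fun e => ε e ω)‖ ∂P) ∧
        ∫ ω, ‖α.graphMatrix n (fun e => ε e ω)‖ ∂P ≤
          C * ((n : ℝ) ^ (α.polyExponent / 2) * Real.log n ^ (α.logExponent / 2)) := by
  refine ⟨α.lowerConst, α.upperConst, α.lowerConst_pos,
    zero_lt_one.trans_le α.one_le_upperConst, fun n Ω _ P _ ε hε => ?_⟩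
  rw [hε.integral_eq_expect fun x => ‖α.graphMatrix n x‖]
  refine ⟨α.lowerConst_mul_le, ?_⟩
  rcases le_or_gt n 1 with hn | hn
  · exact α.expect_norm_le_of_le_one hn
  · exact α.expect_norm_le_of_two_le hn
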